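/- Let $\Omega\subset\mathbb C^d$ ($d\ge 1$) be an irreducible bounded symmetric domain, i.e. a bounded domain each of whose points is an isolated fixed point of an involutive holomorphic automorphism, and which is not biholomorphic to a product of two bounded symmetric domains of positive dimension. Let $K$ be its Bergman kernel, $V$ its Euclidean volume, $\gamma$ its genus, and $N(z)=(V\,K(z,z))^{-1/\gamma}$ its generic norm. (For rank $r$ and multiplicities $a,b$ the genus is $\gamma=2+a(r-1)+b$; that is, $\gamma-2$ is the dimension of $\{v:\{e\,e\,v\}=v\}$ for a primitive tripotent $e$, $\{e\,e\,e\}=2e$, of the Jordan triple system on a tangent space of $\Omega$ given by $h(\{u\,v\,w\},t)=-R(u,\bar v,w,\bar t)$, where $h=\partial\bar\partial\log K(z,z)$ is the Bergman metric and $R$ its curvature tensor, $R_{j\bar kl\bar m}=-\partial_l\bar\partial_m h_{j\bar k}+\sum_{p,q}h^{p\bar q}\,\partial_l h_{j\bar p}\,\bar\partial_m h_{q\bar k}$.) For a real number $\mu>0$ let $M=\{(z,w)\in\Omega\times\mathbb C:\ |w|^2<N(z)^\mu\}\subset\mathbb C^{d+1}$, and let $g=g(\mu)$ be given on $M$, with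 $z_{d+1}=w$, by $g_{\alpha\bar\beta}=-\dfrac{\partial^2\log(N^\mu-|w|^2)}{\partial z_\alpha\partial\bar z_\beta}$. Put $\mathrm{Ric}_{\alpha\bar\beta}=-\dfrac{\partial^2\log\det g}{\partial z_\alpha\partial\bar z_\beta}$ and $\kappa=\sum_{\alpha,\beta}g^{\beta\bar\alpha}\,\mathrm{Ric}_{\alpha\bar\beta}$. Then $g$ is a Kähler metric on $M$; its scalar curvature is $$\kappa(z,w)=\frac{d\,(\mu(d+1)-\gamma)}{\mu}\cdot\frac{N(z)^\mu-|w|^2}{N(z)^\mu}-(d+2)(d+1)\qquad\text{for all }(z,w)\in M;$$ $\kappa$ is constant on $M$ if and only if $\mu(d+1)=\gamma$; and $g$ is Kähler–Einstein (that is, $\mathrm{Ric}=c\,g$ on $M$ for some real constant $c$) if and only if $\mu(d+1)=\gamma$. -/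

import Mathlib

open scoped ComplexOrder ContDiff

namespace CartanHartogs

section Calculus

variable {ι : Type*} [Fintype ι] [DecidableEq ι]

/-- The Wirtinger derivative `∂f/∂z_j`. -/
noncomputable def dz (j : ι) (f : (ι → ℂ) → ℂ) (x : ι → ℂ) : ℂ :=
  (1 / 2) * (fderiv ℝ f x (Pi.single j 1) - Complex.I * fderiv ℝ f x (Pi.single j Complex.I))

/-- The Wirtinger derivative `∂f/∂z̄_j`. -/
noncomputable def dzbar (j : ι) (f : (ι → ℂ) → ℂ) (x : ι → ℂ) : ℂ :=
  (1 / 2) * (fderiv ℝ f x (Pi.single j 1) + Complex.I * fderiv ℝ f x (Pi.single j Complex.I))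

/-- The Hermitian matrix `g_{jk̄} = ∂²φ/∂z_j∂z̄_k` of the metric with potential `φ`. -/
noncomputable def metricOfPotential (φ : (ι → ℂ) → ℝ) (x : ι → ℂ) : Matrix ι ι ℂ :=
  Matrix.of fun j k => dz j (dzbar k fun y => (φ y : ℂ)) x

/-- `g` is a Kähler metric on the open set `M`: its matrix `g_{jk̄}` is smooth and Hermitian
positive definite, and its Kähler form is closed. -/
def IsKahlerMetricOn (M : Set (ι → ℂ)) (g : (ι → ℂ) → Matrix ι ι ℂ) : Prop :=
  (∀ j k, ContDiffOn ℝ ∞ (fun x => g x j k) M) ∧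
  (∀ x ∈ M, (g x).PosDef) ∧
  (∀ x ∈ M, ∀ i j k, dz i (fun y => g y j k) x = dz j (fun y => g y i k) x)

/-- The Ricci tensor `Ric_{jk̄} = -∂² log det g / ∂z_j∂z̄_k` of a Kähler metric. -/
noncomputable def ricci (g : (ι → ℂ) → Matrix ι ι ℂ) (x : ι → ℂ) : Matrix ι ι ℂ :=
  Matrix.of fun j k => -dz j (dzbar k fun y => Complex.log (g y).det) x

/-- The scalar curvature `κ = ∑_{j,k} g^{kj̄} Ric_{jk̄}` of a Kähler metric. -/
noncomputable def scalarCurvature (g : (ι → ℂ) → Matrix ι ι ℂ) (x : ι → ℂ) : ℂ :=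
  ∑ j, ∑ k, (g x)⁻¹ k j * ricci g x j k

/-- `g` is a Kähler–Einstein metric on `M`: `Ric = c g` with a real constant `c`. -/
def IsKahlerEinsteinOn (M : Set (ι → ℂ)) (g : (ι → ℂ) → Matrix ι ι ℂ) : Prop :=
  IsKahlerMetricOn M g ∧ ∃ c : ℝ, ∀ x ∈ M, ricci g x = (c : ℂ) • g x

/-- The curvature tensor
`R_{jk̄lm̄} = -∂²g_{jk̄}/∂z_l∂z̄_m + ∑_{p,q} g^{pq} (∂g_{jp̄}/∂z_l) (∂g_{qk̄}/∂z̄_m)`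
of a Kähler metric. -/
noncomputable def curvature (g : (ι → ℂ) → Matrix ι ι ℂ) (x : ι → ℂ) (j k l m : ι) : ℂ :=
  -dz l (dzbar m fun y => g y j k) x +
    ∑ p, ∑ q, (g x)⁻¹ p q * dz l (fun y => g y j p) x * dzbar m (fun y => g y q k) x

end Calculus

section Domains

/-- `A` and `B` are biholomorphic. -/
def Biholomorphic {E F : Type*} [NormedAddCommGroup E] [NormedSpace ℂ E]
    [NormedAddCommGroup F] [NormedSpace ℂ F] (A : Set E) (B : Set F) : Prop :=
  ∃ (f : E → F) (h : F → E), DifferentiableOn ℂ f A ∧ DifferentiableOn ℂ h B ∧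
    Set.MapsTo f A B ∧ Set.MapsTo h B A ∧ Set.InvOn h f A B

/-- A bounded symmetric domain of `ℂ^d`: a bounded domain each point of which is an isolated
fixed point of an involutive holomorphic automorphism. -/
structure IsBoundedSymmetricDomain {d : ℕ} (Ω : Set (Fin d → ℂ)) : Prop where
  isOpen : IsOpen Ω
  isConnected : IsConnected Ω
  isBounded : Bornology.IsBounded Ω
  symmetry : ∀ p ∈ Ω, ∃ s : (Fin d → ℂ) → (Fin d → ℂ),
    DifferentiableOn ℂ s Ω ∧ Set.MapsTo s Ω Ω ∧ (∀ z ∈ Ω, s (s z) = z) ∧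
    s p = p ∧ ∀ᶠ z in nhdsWithin p {p}ᶜ, s z ≠ z

/-- `Ω` has positive dimension and is not biholomorphic to a product of two bounded symmetric
domains of positive dimension. -/
def IsIrreducibleDomain {d : ℕ} (Ω : Set (Fin d → ℂ)) : Prop :=
  0 < d ∧ ¬ ∃ (m n : ℕ) (A : Set (Fin m → ℂ)) (B : Set (Fin n → ℂ)), 0 < m ∧ 0 < n ∧
    IsBoundedSymmetricDomain A ∧ IsBoundedSymmetricDomain B ∧ Biholomorphic Ω (A ×ˢ B)

end Domains

section Bergman

variable {d : ℕ}

/-- The Bergman space of square integrable holomorphic functions on `Ω`. -/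
def bergmanSpace (Ω : Set (Fin d → ℂ)) : Set ((Fin d → ℂ) → ℂ) :=
  {f | DifferentiableOn ℂ f Ω ∧
    MeasureTheory.MemLp f 2 (MeasureTheory.volume.restrict Ω)}

/-- `K` is a reproducing kernel of the Bergman space of `Ω`: `K(·, w)` lies in the Bergman space
and `f(w) = ∫_Ω f(z) conj(K(z, w)) dV(z)`. These two conditions determine `K` on `Ω × Ω`. -/
def IsBergmanKernel (Ω : Set (Fin d → ℂ)) (K : (Fin d → ℂ) → (Fin d → ℂ) → ℂ) : Prop :=
  ∀ w ∈ Ω, (fun z => K z w) ∈ bergmanSpace Ω ∧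
    ∀ f ∈ bergmanSpace Ω, f w = ∫ z in Ω, f z * (starRingEnd ℂ) (K z w)

/-- The Bergman kernel of `Ω`. Only its values on `Ω × Ω` are meaningful. -/
noncomputable def bergmanKernel (Ω : Set (Fin d → ℂ)) : (Fin d → ℂ) → (Fin d → ℂ) → ℂ :=
  Classical.epsilon (IsBergmanKernel Ω)

/-- The Bergman metric, with potential `log K(z, z)`. -/
noncomputable def bergmanMetric (Ω : Set (Fin d → ℂ)) : (Fin d → ℂ) → Matrix (Fin d) (Fin d) ℂ :=
  metricOfPotential fun z => Real.log (bergmanKernel Ω z z).re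

/-- The operator `D(u, v)`, `D(u, v) w = {u v w}`, of the Jordan triple system on the tangent space
of `Ω` at `p`. The triple product is given by `h({u v w}, t) = -R(u, v̄, w, t̄)`, where
`h(x, y) = ∑ g_{jk̄} x_j conj(y_k)` and `R` are the Bergman metric and its curvature at `p`.
For a circled domain and `p = 0` this is the usual
`h({u v w}, t) = ∂_u ∂̄_v ∂_w ∂̄_t log K(z, z)` at `z = 0`. -/
noncomputable def jordanD (Ω : Set (Fin d → ℂ)) (p u v : Fin d → ℂ) : Matrix (Fin d) (Fin d) ℂ :=
  Matrix.of fun i l => ∑ j, ∑ k, ∑ m,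
    -curvature (bergmanMetric Ω) p j k l m * u j * (starRingEnd ℂ) (v k) *
      (bergmanMetric Ω p)⁻¹ m i

/-- Tripotents, `{e e e} = 2e` (so that `D(e, e)` has eigenvalues `0, 1, 2`). -/
def IsTripotent (Ω : Set (Fin d → ℂ)) (p e : Fin d → ℂ) : Prop :=
  (jordanD Ω p e e).mulVec e = (2 : ℂ) • e

/-- A primitive tripotent: non-zero, and not the sum of two non-zero orthogonal tripotents. -/
def IsPrimitiveTripotent (Ω : Set (Fin d → ℂ)) (p e : Fin d → ℂ) : Prop :=
  IsTripotent Ω p e ∧ e ≠ 0 ∧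
    ¬ ∃ a b : Fin d → ℂ, IsTripotent Ω p a ∧ IsTripotent Ω p b ∧ a ≠ 0 ∧ b ≠ 0 ∧
      jordanD Ω p a b = 0 ∧ e = a + b

/-- The genus `γ = 2 + a(r - 1) + b` of an irreducible bounded symmetric domain of rank `r` with
multiplicities `a`, `b`. Here `a(r - 1) + b` is the dimension of the Peirce space
`V₁(e) = {v | {e e v} = v}` of a primitive tripotent `e`; it is the same for all `e` (and all base
points), so that the infimum is over a one-point set. -/
noncomputable def genus (Ω : Set (Fin d → ℂ)) : ℕ :=
  2 + sInf {n : ℕ | ∃ p ∈ Ω, ∃ e, IsPrimitiveTripotent Ω p e ∧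
    n = Module.finrank ℂ (Module.End.eigenspace (Matrix.toLin' (jordanD Ω p e e)) 1)}

/-- The generic norm `N(z, z) = (V(Ω) K(z, z))^(-1/γ)`. -/
noncomputable def genericNorm (Ω : Set (Fin d → ℂ)) (z : Fin d → ℂ) : ℝ :=
  (MeasureTheory.volume.real Ω * (bergmanKernel Ω z z).re) ^ (-1 / (genus Ω : ℝ))

end Bergman

section CartanHartogs

variable {d : ℕ}

/-- The component `z ∈ ℂ^d` of a point `x = (z, w)` of `ℂ^(d+1)`. -/
def zPart (x : Fin (d + 1) → ℂ) : Fin d → ℂ := fun j => x j.castSucc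

/-- The component `w ∈ ℂ` of a point `x = (z, w)` of `ℂ^(d+1)`. -/
def wPart (x : Fin (d + 1) → ℂ) : ℂ := x (Fin.last d)

/-- The Cartan–Hartogs domain `{(z, w) ∈ Ω × ℂ : |w|² < N(z, z)^μ}`. -/
def cartanHartogsDomain (Ω : Set (Fin d → ℂ)) (μ : ℝ) : Set (Fin (d + 1) → ℂ) :=
  {x | zPart x ∈ Ω ∧ ‖wPart x‖ ^ 2 < genericNorm Ω (zPart x) ^ μ}

/-- The metric `g(μ)`, with potential `-log(N(z, z)^μ - |w|²)`. -/
noncomputable def cartanHartogsMetric (Ω : Set (Fin d → ℂ)) (μ : ℝ) :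
    (Fin (d + 1) → ℂ) → Matrix (Fin (d + 1)) (Fin (d + 1)) ℂ :=
  metricOfPotential fun x => -Real.log (genericNorm Ω (zPart x) ^ μ - ‖wPart x‖ ^ 2)

end CartanHartogs

end CartanHartogs

/-!
The statement depends on the genus only through the exponent `ν = μ / γ > 0`: up to a constant
factor, `E = N ^ μ` is the power `K(z, z) ^ (-ν)` of the Bergman kernel. The proof has three
ingredients.

*The Bergman kernel.* For any open set, the evaluation `Φ z` at `z ∈ Ω` is a bounded functional on
the Bergman space, by the mean value property over polydiscs (`setIntegral_closedBall_eq`), and it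
depends holomorphically on `z` in operator norm (`IsEvaluation.differentiableOn`). Hence
`K(z, z) = ‖Φ z‖²` is smooth, and for bounded `Ω` the Levi form of `log ‖Φ‖²` is positive definite
by the equality case of the Cauchy–Schwarz inequality
(`posDef_metricOfPotential_log_norm_sq`).

*The volume density.* On a bounded symmetric domain `det ∂∂̄ log K = C · K` with a constant `C`
(`exists_log_det_bergmanMetric`). Both sides acquire the same factor `|det s'|²` under an involutive
automorphism `s` (`bergmanMetric_eq_mul`, `bergmanDiag_eq_mul_comp`), so their quotient is
`s`-invariant. The symmetry at `p` has derivative `-1` at `p`, because an involution can be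
linearized at a fixed point and the fixed point is isolated (`fderiv_apply_eq_neg`). The
differential of the quotient therefore vanishes at each `p`.

*The Hartogs metric.* Write `q = E - |w|²`, let `H` be the pullback of `∂∂̄(-log E)` to `Ω × ℂ`, and
let `a = w ∂(-log E) + dw`. Then `g = (E / q) H + (E / q²) a a*`
(`metricOfPotential_hartogsPotential`), where `H` has no `w`-components and `a` has last component
`1`. This gives positivity, `det g = E ^ (d + 1) q ^ (-(d + 2)) det H` and `tr (g⁻¹ H) = d q / E`
(`det_smul_add_vecMulVec`, `posDef_smul_add_vecMulVec`, `trace_inv_mul`), where in the determinant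
formula `H` stands for its `d × d` block. With `det H = C' E ^ (-γ / μ)` it follows that
`Ric = -(d + 2) g + (d + 1 - γ / μ) H` (`ricci_hartogsMetric`), whose trace is the asserted scalar
curvature. Since `q / E` takes the values `1` and `1 / 2` on each fibre, the scalar curvature is
constant only if its coefficient vanishes; in that case `Ric = -(d + 2) g`, and conversely the trace
of an Einstein equation is constant.
-/

namespace CartanHartogs

/-! ### Holomorphic functions of several variables -/

section SeveralComplexVariables

open Metric Set MeasureTheory
open scoped Real Topology

variable {E F : Type*} [NormedAddCommGroup E] [NormedSpace ℂ E]
  [NormedAddCommGroup F] [NormedSpace ℂ F]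

/-- The restriction of a function to a complex line is holomorphic where the line stays in the
domain. -/
theorem differentiableOn_comp_line {U : Set E} {f : E → F} (hU : IsOpen U)
    (hf : DifferentiableOn ℂ f U) (x v : E) :
    DifferentiableOn ℂ (fun ζ : ℂ => f (x + ζ • v)) {ζ : ℂ | x + ζ • v ∈ U} := by
  intro ζ hζ
  have h1 : DifferentiableAt ℂ f (x + ζ • v) := hf.differentiableAt (hU.mem_nhds hζ)
  have h2 : DifferentiableAt ℂ (fun ζ : ℂ => x + ζ • v) ζ := by fun_prop
  exact (DifferentiableAt.comp ζ h1 h2).differentiableWithinAt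

theorem isOpen_line_preimage {U : Set E} (hU : IsOpen U) (x v : E) :
    IsOpen {ζ : ℂ | x + ζ • v ∈ U} :=
  hU.preimage (by fun_prop : Continuous fun ζ : ℂ => x + ζ • v)

theorem deriv_comp_line {U : Set E} {f : E → F} (hU : IsOpen U) (hf : DifferentiableOn ℂ f U)
    {x : E} (hx : x ∈ U) (v : E) :
    deriv (fun ζ : ℂ => f (x + ζ • v)) 0 = fderiv ℂ f x v := by
  have h1 : HasFDerivAt f (fderiv ℂ f x) (x + (0 : ℂ) • v) := by
    simpa using (hf.differentiableAt (hU.mem_nhds hx)).hasFDerivAt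
  have h2 : HasDerivAt (fun ζ : ℂ => x + ζ • v) v 0 := by
    simpa using ((hasDerivAt_id (0 : ℂ)).smul_const v).const_add x
  exact (h1.comp_hasDerivAt (0 : ℂ) h2).deriv

/-- Cauchy's estimate for the derivative of a bounded holomorphic function. -/
theorem norm_fderiv_le_of_norm_le {f : E → F} {x : E} {r M : ℝ} (hr : 0 < r)
    (hf : DifferentiableOn ℂ f (ball x r)) (hM : ∀ z ∈ ball x r, ‖f z‖ ≤ M) :
    ‖fderiv ℂ f x‖ ≤ 2 * M / r := by
  refine Complex.norm_fderiv_le_div_of_mapsTo_ball hf (fun z hz => ?_) hr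
  rw [mem_closedBall, dist_eq_norm]
  linarith [norm_sub_le (f z) (f x), hM z hz, hM x (mem_ball_self hr)]

/-- Second order Taylor estimate: the remainder of the first order expansion of a holomorphic
function bounded by `M` vanishes to second order, so that Schwarz's lemma applies to it. -/
theorem norm_taylor_remainder_le {f : E → F} {x : E} {r M : ℝ} (hr : 0 < r)
    (hf : DifferentiableOn ℂ f (ball x r)) (hM : ∀ z ∈ ball x r, ‖f z‖ ≤ M) {y : E}
    (hy : ‖y‖ < r) :
    ‖f (x + y) - f x - fderiv ℂ f x y‖ ≤ 4 * M * (‖y‖ / r) ^ 2 := by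
  have hx : DifferentiableAt ℂ f x := hf.differentiableAt (ball_mem_nhds x hr)
  have h := Complex.dist_le_mul_div_pow_of_mapsTo_ball_of_isLittleO (n := 1)
    (f := fun z => f z - fderiv ℂ f x (z - x)) (c := x) (z := x + y) (R₁ := r) (R₂ := 4 * M)
    (hf.sub (by fun_prop)) (fun z hz => ?_) ?_ (by simpa using hy)
  · rw [dist_eq_norm, dist_eq_norm] at h
    simpa [sub_right_comm] using h
  · rw [mem_closedBall, dist_eq_norm]
    have h1 : ‖fderiv ℂ f x (z - x)‖ ≤ 2 * M / r * r :=
      ((fderiv ℂ f x).le_opNorm _).trans (mul_le_mul (norm_fderiv_le_of_norm_le hr hf hM)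
        (by simpa [dist_eq_norm] using (mem_ball.1 hz).le) (norm_nonneg _)
        ((norm_nonneg _).trans (norm_fderiv_le_of_norm_le hr hf hM)))
    rw [div_mul_cancel₀ _ hr.ne'] at h1
    calc ‖f z - fderiv ℂ f x (z - x) - (f x - fderiv ℂ f x (x - x))‖
        = ‖f z - fderiv ℂ f x (z - x) - f x‖ := by simp
      _ ≤ ‖f z‖ + ‖fderiv ℂ f x (z - x)‖ + ‖f x‖ :=
        (norm_sub_le _ _).trans (add_le_add_left (norm_sub_le _ _) _)
      _ ≤ 4 * M := by linarith [hM z hz, hM x (mem_ball_self hr)]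
  · have h2 := hx.hasFDerivAt.isLittleO
    refine (h2.congr_left fun z => ?_).trans_isBigO ?_
    · simp only [sub_self, map_zero, sub_zero]; abel
    · simpa using (Asymptotics.isBigO_refl (fun z => z - x) (𝓝 x)).norm_right

variable [CompleteSpace F]

/-- The Cauchy integral formula for a directional derivative. -/
theorem fderiv_apply_eq_circleIntegral {U : Set E} {f : E → F} (hU : IsOpen U)
    (hf : DifferentiableOn ℂ f U) {x v : E} {r : ℝ} (hr : 0 < r)
    (h : ∀ ζ ∈ closedBall (0 : ℂ) r, x + ζ • v ∈ U) :
    fderiv ℂ f x v = (2 * π * Complex.I : ℂ)⁻¹ • ∫ θ in (0 : ℝ)..2 * π,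
      (deriv (circleMap 0 r) θ * ((circleMap 0 r θ) ^ 2)⁻¹) • f (x + circleMap 0 r θ • v) := by
  have hx : x ∈ U := by simpa using h 0 (by simp [hr.le])
  rw [← deriv_comp_line hU hf hx v,
    ← Complex.two_pi_I_inv_smul_circleIntegral_sub_sq_inv_smul_of_differentiable
      (isOpen_line_preimage hU x v) (c := 0) (R := r) h (differentiableOn_comp_line hU hf x v)
      (mem_ball_self hr)]
  simp only [circleIntegral, sub_zero, smul_smul]

/-- The directional derivatives of a holomorphic function of several variables are holomorphic:
differentiate the Cauchy integral formula under the integral sign. -/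
theorem differentiableOn_fderiv_apply [FiniteDimensional ℂ E] {U : Set E} {f : E → F}
    (hU : IsOpen U) (hf : DifferentiableOn ℂ f U) (v : E) :
    DifferentiableOn ℂ (fun x => fderiv ℂ f x v) U := by
  have : ProperSpace E := FiniteDimensional.proper ℂ E
  -- Around every point there is a ball on which the Cauchy formula holds with a fixed radius.
  have key : ∀ v : E, ∀ x₀ ∈ U, ∃ ρ > 0, ∃ r > 0, closedBall x₀ ρ ⊆ U ∧
      ∀ x ∈ ball x₀ (ρ / 2), ∀ ζ ∈ closedBall (0 : ℂ) r, x + ζ • v ∈ closedBall x₀ ρ := by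
    intro v x₀ hx₀
    obtain ⟨ρ, hρ, hρU⟩ := nhds_basis_closedBall.mem_iff.1 (hU.mem_nhds hx₀)
    refine ⟨ρ, hρ, ρ / 2 / (‖v‖ + 1), by positivity, hρU, fun x hx ζ hζ => ?_⟩
    rw [mem_closedBall, dist_eq_norm]
    rw [mem_ball, dist_eq_norm] at hx
    rw [mem_closedBall, dist_zero_right, le_div_iff₀ (by positivity)] at hζ
    calc ‖x + ζ • v - x₀‖ = ‖(x - x₀) + ζ • v‖ := by congr 1; abel
      _ ≤ ‖x - x₀‖ + ‖ζ‖ * ‖v‖ := (norm_add_le _ _).trans (by rw [norm_smul])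
      _ ≤ ρ := by nlinarith [norm_nonneg ζ]
  have hcirc : ∀ {r : ℝ}, 0 < r → ∀ θ, circleMap 0 r θ ∈ closedBall (0 : ℂ) r := fun hr θ =>
    circleMap_mem_closedBall 0 hr.le θ
  have hc : ∀ {r : ℝ}, 0 < r → Continuous fun θ =>
      deriv (circleMap 0 r) θ * ((circleMap 0 r θ) ^ 2)⁻¹ := by
    intro r hr
    simp only [deriv_circleMap]
    refine Continuous.mul (by fun_prop) (Continuous.inv₀ (by fun_prop) fun θ => ?_)
    simp [hr.ne']
  have hcomp : ∀ {g : E → F}, ContinuousOn g U → ∀ {ρ r : ℝ} {x₀ : E} {v : E}, 0 < r →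
      closedBall x₀ ρ ⊆ U →
      (∀ x ∈ ball x₀ (ρ / 2), ∀ ζ ∈ closedBall (0 : ℂ) r, x + ζ • v ∈ closedBall x₀ ρ) →
      ∀ x ∈ ball x₀ (ρ / 2), Continuous fun θ : ℝ =>
        (deriv (circleMap 0 r) θ * ((circleMap 0 r θ) ^ 2)⁻¹) • g (x + circleMap 0 r θ • v) := by
    intro g hg ρ r x₀ v hr hρU hin x hx
    refine (hc hr).smul (hg.comp_continuous (by fun_prop) fun θ => hρU (hin x hx _ (hcirc hr θ)))
  -- First step: continuity of the derivative.
  have hcont : ContinuousOn (fderiv ℂ f) U := by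
    refine continuousOn_clm_apply.2 fun v x₀ hx₀ => ContinuousAt.continuousWithinAt ?_
    obtain ⟨ρ, hρ, r, hr, hρU, hin⟩ := key v x₀ hx₀
    have hball : ball x₀ (ρ / 2) ∈ 𝓝 x₀ := ball_mem_nhds _ (by positivity)
    obtain ⟨M, hM⟩ := (isCompact_closedBall x₀ ρ).exists_bound_of_continuousOn
      (hf.continuousOn.mono hρU)
    have heq : (fun x => fderiv ℂ f x v) =ᶠ[𝓝 x₀] fun x => (2 * π * Complex.I : ℂ)⁻¹ •
        ∫ θ in (0 : ℝ)..2 * π,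
          (deriv (circleMap 0 r) θ * ((circleMap 0 r θ) ^ 2)⁻¹) • f (x + circleMap 0 r θ • v) :=
      Filter.eventually_of_mem hball fun x hx =>
        fderiv_apply_eq_circleIntegral hU hf hr fun ζ hζ => hρU (hin x hx ζ hζ)
    refine ContinuousAt.congr ?_ heq.symm
    refine ContinuousAt.const_smul (intervalIntegral.continuousAt_of_dominated_interval
      (bound := fun θ => ‖deriv (circleMap 0 r) θ * ((circleMap 0 r θ) ^ 2)⁻¹‖ * M) ?_ ?_ ?_ ?_) _
    · exact Filter.eventually_of_mem hball fun x hx =>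
        (hcomp hf.continuousOn hr hρU hin x hx).aestronglyMeasurable
    · refine Filter.eventually_of_mem hball fun x hx => Filter.Eventually.of_forall fun θ _ => ?_
      rw [norm_smul]
      exact mul_le_mul_of_nonneg_left (hM _ (hin x hx _ (hcirc hr θ))) (norm_nonneg _)
    · exact ((hc hr).norm.mul continuous_const).intervalIntegrable _ _
    · refine Filter.Eventually.of_forall fun θ _ => ContinuousAt.const_smul ?_ _
      have h1 : ContinuousAt f (x₀ + circleMap 0 r θ • v) := (hf.differentiableAt (hU.mem_nhds
        (hρU (hin x₀ (mem_ball_self (by positivity)) _ (hcirc hr θ))))).continuousAt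
      exact ContinuousAt.comp (f := fun x => x + circleMap 0 r θ • v) h1 (by fun_prop)
  -- Second step: differentiation under the integral sign.
  intro x₀ hx₀
  refine DifferentiableAt.differentiableWithinAt ?_
  obtain ⟨ρ, hρ, r, hr, hρU, hin⟩ := key v x₀ hx₀
  have hx₀b : x₀ ∈ ball x₀ (ρ / 2) := mem_ball_self (by positivity)
  have hball : ball x₀ (ρ / 2) ∈ 𝓝 x₀ := ball_mem_nhds _ (by positivity)
  obtain ⟨M, hM⟩ := (isCompact_closedBall x₀ ρ).exists_bound_of_continuousOn (hcont.mono hρU)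
  have heq : (fun x => fderiv ℂ f x v) =ᶠ[𝓝 x₀] fun x => (2 * π * Complex.I : ℂ)⁻¹ •
      ∫ θ in (0 : ℝ)..2 * π,
        (deriv (circleMap 0 r) θ * ((circleMap 0 r θ) ^ 2)⁻¹) • f (x + circleMap 0 r θ • v) :=
    Filter.eventually_of_mem hball fun x hx =>
      fderiv_apply_eq_circleIntegral hU hf hr fun ζ hζ => hρU (hin x hx ζ hζ)
  refine DifferentiableAt.congr_of_eventuallyEq ?_ heq
  refine DifferentiableAt.const_smul (HasFDerivAt.differentiableAt
    (intervalIntegral.hasFDerivAt_integral_of_dominated_of_fderiv_le (s := ball x₀ (ρ / 2))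
      (F' := fun x θ => (deriv (circleMap 0 r) θ * ((circleMap 0 r θ) ^ 2)⁻¹) •
        fderiv ℂ f (x + circleMap 0 r θ • v))
      (bound := fun θ => ‖deriv (circleMap 0 r) θ * ((circleMap 0 r θ) ^ 2)⁻¹‖ * M)
      hball ?_ ?_ ?_ ?_ ?_ ?_)) _
  · exact Filter.eventually_of_mem hball fun x hx =>
      (hcomp hf.continuousOn hr hρU hin x hx).aestronglyMeasurable
  · exact (hcomp hf.continuousOn hr hρU hin x₀ hx₀b).intervalIntegrable _ _
  · refine Continuous.aestronglyMeasurable ((hc hr).smul (hcont.comp_continuous (by fun_prop)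
      fun θ => hρU (hin x₀ hx₀b _ (hcirc hr θ))))
  · refine Filter.Eventually.of_forall fun θ _ x hx => ?_
    rw [norm_smul]
    exact mul_le_mul_of_nonneg_left (hM _ (hin x hx _ (hcirc hr θ))) (norm_nonneg _)
  · exact ((hc hr).norm.mul continuous_const).intervalIntegrable _ _
  · refine Filter.Eventually.of_forall fun θ _ x hx => HasFDerivAt.const_smul ?_ _
    have h1 : HasFDerivAt f (fderiv ℂ f (x + circleMap 0 r θ • v)) (x + circleMap 0 r θ • v) :=
      (hf.differentiableAt (hU.mem_nhds (hρU (hin x hx _ (hcirc hr θ))))).hasFDerivAt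
    exact (hasFDerivAt_comp_add_right (circleMap 0 r θ • v)).2 h1

/-- Holomorphic functions of several variables are smooth. -/
theorem contDiffOn_of_differentiableOn [FiniteDimensional ℂ E] {U : Set E} {f : E → F}
    (hU : IsOpen U) (hf : DifferentiableOn ℂ f U) : ContDiffOn ℂ ∞ f U := by
  refine contDiffOn_infty.2 fun n => ?_
  induction n generalizing f with
  | zero => exact contDiffOn_zero.2 hf.continuousOn
  | succ n ih =>
    rw [Nat.cast_add, Nat.cast_one, contDiffOn_succ_iff_fderiv_of_isOpen hU]
    refine ⟨hf, by simp, contDiffOn_clm_apply.2 fun v => ih (differentiableOn_fderiv_apply hU hf v)⟩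

end SeveralComplexVariables

/-! ### Wirtinger calculus -/

section WirtingerCalculus

set_option linter.unusedSectionVars false

open scoped Topology ComplexConjugate

variable {ι κ : Type*} [Fintype ι] [DecidableEq ι] [Fintype κ] [DecidableEq κ]

theorem dz_congr {f g : (ι → ℂ) → ℂ} {x : ι → ℂ} (h : f =ᶠ[𝓝 x] g) (j : ι) :
    dz j f x = dz j g x := by
  simp only [dz, h.fderiv_eq]

theorem dzbar_congr {f g : (ι → ℂ) → ℂ} {x : ι → ℂ} (h : f =ᶠ[𝓝 x] g) (j : ι) :
    dzbar j f x = dzbar j g x := by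
  simp only [dzbar, h.fderiv_eq]

@[simp] theorem dz_const (j : ι) (c : ℂ) (x : ι → ℂ) : dz j (fun _ => c) x = 0 := by
  simp [dz]

@[simp] theorem dzbar_const (j : ι) (c : ℂ) (x : ι → ℂ) : dzbar j (fun _ => c) x = 0 := by
  simp [dzbar]

theorem dz_add {f g : (ι → ℂ) → ℂ} {x : ι → ℂ} (hf : DifferentiableAt ℝ f x)
    (hg : DifferentiableAt ℝ g x) (j : ι) :
    dz j (fun y => f y + g y) x = dz j f x + dz j g x := by
  simp only [dz, (hf.hasFDerivAt.fun_add hg.hasFDerivAt).fderiv, add_apply]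
  ring

theorem dzbar_add {f g : (ι → ℂ) → ℂ} {x : ι → ℂ} (hf : DifferentiableAt ℝ f x)
    (hg : DifferentiableAt ℝ g x) (j : ι) :
    dzbar j (fun y => f y + g y) x = dzbar j f x + dzbar j g x := by
  simp only [dzbar, (hf.hasFDerivAt.fun_add hg.hasFDerivAt).fderiv, add_apply]
  ring

theorem dz_mul {f g : (ι → ℂ) → ℂ} {x : ι → ℂ} (hf : DifferentiableAt ℝ f x)
    (hg : DifferentiableAt ℝ g x) (j : ι) :
    dz j (fun y => f y * g y) x = dz j f x * g x + f x * dz j g x := by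
  simp only [dz, (hf.hasFDerivAt.fun_mul hg.hasFDerivAt).fderiv, add_apply,
    smul_apply, smul_eq_mul]
  ring

theorem dzbar_mul {f g : (ι → ℂ) → ℂ} {x : ι → ℂ} (hf : DifferentiableAt ℝ f x)
    (hg : DifferentiableAt ℝ g x) (j : ι) :
    dzbar j (fun y => f y * g y) x = dzbar j f x * g x + f x * dzbar j g x := by
  simp only [dzbar, (hf.hasFDerivAt.fun_mul hg.hasFDerivAt).fderiv, add_apply,
    smul_apply, smul_eq_mul]
  ring

theorem dz_const_mul {f : (ι → ℂ) → ℂ} {x : ι → ℂ} (hf : DifferentiableAt ℝ f x) (c : ℂ)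
    (j : ι) : dz j (fun y => c * f y) x = c * dz j f x := by
  simp [dz_mul (differentiableAt_const c) hf]

theorem dzbar_const_mul {f : (ι → ℂ) → ℂ} {x : ι → ℂ} (hf : DifferentiableAt ℝ f x) (c : ℂ)
    (j : ι) : dzbar j (fun y => c * f y) x = c * dzbar j f x := by
  simp [dzbar_mul (differentiableAt_const c) hf]

theorem dz_sum {σ : Type*} {s : Finset σ} {f : σ → (ι → ℂ) → ℂ} {x : ι → ℂ}
    (hf : ∀ i ∈ s, DifferentiableAt ℝ (f i) x) (j : ι) :
    dz j (fun y => ∑ i ∈ s, f i y) x = ∑ i ∈ s, dz j (f i) x := by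
  simp only [dz, fderiv_fun_sum hf, sum_apply]
  rw [Finset.mul_sum s _ Complex.I, ← Finset.sum_sub_distrib, Finset.mul_sum]

theorem fderiv_comp_of_hasDerivAt {f : (ι → ℂ) → ℂ} {g : ℂ → ℂ} {g' : ℂ} {x : ι → ℂ}
    (hf : DifferentiableAt ℝ f x) (hg : HasDerivAt g g' (f x)) :
    fderiv ℝ (fun y => g (f y)) x = g' • fderiv ℝ f x := by
  have h := (hg.hasFDerivAt.restrictScalars ℝ).comp x hf.hasFDerivAt
  rw [show (fun y => g (f y)) = g ∘ f from rfl, h.fderiv]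
  ext v
  simp [mul_comm]

theorem dz_comp {f : (ι → ℂ) → ℂ} {g : ℂ → ℂ} {g' : ℂ} {x : ι → ℂ}
    (hf : DifferentiableAt ℝ f x) (hg : HasDerivAt g g' (f x)) (j : ι) :
    dz j (fun y => g (f y)) x = g' * dz j f x := by
  simp only [dz, fderiv_comp_of_hasDerivAt hf hg, smul_apply, smul_eq_mul]
  ring

theorem dzbar_comp {f : (ι → ℂ) → ℂ} {g : ℂ → ℂ} {g' : ℂ} {x : ι → ℂ}
    (hf : DifferentiableAt ℝ f x) (hg : HasDerivAt g g' (f x)) (j : ι) :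
    dzbar j (fun y => g (f y)) x = g' * dzbar j f x := by
  simp only [dzbar, fderiv_comp_of_hasDerivAt hf hg, smul_apply, smul_eq_mul]
  ring

theorem fderiv_conj {f : (ι → ℂ) → ℂ} {x : ι → ℂ} (hf : DifferentiableAt ℝ f x) (v : ι → ℂ) :
    fderiv ℝ (fun y => conj (f y)) x v = conj (fderiv ℝ f x v) := by
  have h := (Complex.conjCLE.hasFDerivAt (x := f x)).comp x hf.hasFDerivAt
  rw [show (fun y => conj (f y)) = Complex.conjCLE ∘ f from rfl, h.fderiv]
  simp

theorem dz_conj {f : (ι → ℂ) → ℂ} {x : ι → ℂ} (hf : DifferentiableAt ℝ f x) (j : ι) :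
    dz j (fun y => conj (f y)) x = conj (dzbar j f x) := by
  simp only [dz, dzbar, fderiv_conj hf, map_mul, map_add, Complex.conj_I, map_div₀, map_one,
    map_ofNat]
  ring

theorem dzbar_conj {f : (ι → ℂ) → ℂ} {x : ι → ℂ} (hf : DifferentiableAt ℝ f x) (j : ι) :
    dzbar j (fun y => conj (f y)) x = conj (dz j f x) := by
  simp only [dz, dzbar, fderiv_conj hf, map_mul, map_sub, Complex.conj_I, map_div₀, map_one,
    map_ofNat]
  ring

theorem single_I (j : ι) : (Pi.single j Complex.I : ι → ℂ) = Complex.I • Pi.single j 1 := by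
  rw [← Pi.single_smul, smul_eq_mul, mul_one]

theorem dz_of_differentiableAt {f : (ι → ℂ) → ℂ} {x : ι → ℂ} (hf : DifferentiableAt ℂ f x)
    (j : ι) : dz j f x = fderiv ℂ f x (Pi.single j 1) := by
  simp only [dz, hf.fderiv_restrictScalars ℝ, single_I, ContinuousLinearMap.coe_restrictScalars',
    map_smul, smul_eq_mul]
  ring_nf
  simp
  ring

theorem dzbar_of_differentiableAt {f : (ι → ℂ) → ℂ} {x : ι → ℂ} (hf : DifferentiableAt ℂ f x)
    (j : ι) : dzbar j f x = 0 := by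
  simp only [dzbar, hf.fderiv_restrictScalars ℝ, single_I, ContinuousLinearMap.coe_restrictScalars',
    map_smul, smul_eq_mul]
  ring_nf
  simp

theorem dz_conj_of_differentiableAt {f : (ι → ℂ) → ℂ} {x : ι → ℂ} (hf : DifferentiableAt ℂ f x)
    (j : ι) : dz j (fun y => conj (f y)) x = 0 := by
  rw [dz_conj (hf.restrictScalars ℝ), dzbar_of_differentiableAt hf, map_zero]

/-- A real-linear form on `ℂ^ι` is recovered from its complex-linear and antilinear components. -/
theorem clm_apply_eq_sum (L : (ι → ℂ) →L[ℝ] ℂ) (u : ι → ℂ) :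
    L u = ∑ l, ((1 / 2 * (L (Pi.single l 1) - Complex.I * L (Pi.single l Complex.I))) * u l +
      (1 / 2 * (L (Pi.single l 1) + Complex.I * L (Pi.single l Complex.I))) * conj (u l)) := by
  conv_lhs => rw [← Finset.univ_sum_single u, map_sum]
  refine Finset.sum_congr rfl fun l _ => ?_
  have h : (Pi.single l (u l) : ι → ℂ) =
      (u l).re • (Pi.single l 1 : ι → ℂ) + (u l).im • (Pi.single l Complex.I : ι → ℂ) := by
    rw [← Pi.single_smul, ← Pi.single_smul, ← Pi.single_add]
    congr 1
    simp only [Complex.real_smul, mul_one]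
    exact (Complex.re_add_im _).symm
  rw [h, map_add, map_smul, map_smul, Complex.real_smul, Complex.real_smul]
  set a := L (Pi.single l 1)
  set b := L (Pi.single l Complex.I)
  have hc : conj (u l) = (u l).re - (u l).im * Complex.I := by
    apply Complex.ext <;> simp
  have hu : u l = (u l).re + (u l).im * Complex.I := (Complex.re_add_im _).symm
  rw [hc]
  linear_combination (b * (u l).im : ℂ) * Complex.I_sq -
    (1 / 2 * (a - Complex.I * b)) * hu

theorem fderiv_eq_sum (f : (ι → ℂ) → ℂ) (x u : ι → ℂ) :
    fderiv ℝ f x u = ∑ l, (dz l f x * u l + dzbar l f x * conj (u l)) :=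
  clm_apply_eq_sum _ u

theorem fderiv_comp_of_differentiableAt {f : (ι → ℂ) → ℂ} {s : (κ → ℂ) → ι → ℂ} {x : κ → ℂ}
    (hf : DifferentiableAt ℝ f (s x)) (hs : DifferentiableAt ℂ s x) (v : κ → ℂ) :
    fderiv ℝ (fun y => f (s y)) x v = fderiv ℝ f (s x) (fderiv ℂ s x v) := by
  have h := hf.hasFDerivAt.comp x (hs.hasFDerivAt.restrictScalars ℝ)
  rw [show (fun y => f (s y)) = f ∘ s from rfl, h.fderiv]
  simp

/-- Chain rule for `∂/∂z_j` along a holomorphic map. -/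
theorem dz_comp_of_differentiableAt {f : (ι → ℂ) → ℂ} {s : (κ → ℂ) → ι → ℂ} {x : κ → ℂ}
    (hf : DifferentiableAt ℝ f (s x)) (hs : DifferentiableAt ℂ s x) (j : κ) :
    dz j (fun y => f (s y)) x = ∑ l, dz l f (s x) * fderiv ℂ s x (Pi.single j 1) l := by
  rw [dz, fderiv_comp_of_differentiableAt hf hs, fderiv_comp_of_differentiableAt hf hs, single_I,
    map_smul, fderiv_eq_sum, fderiv_eq_sum, Finset.mul_sum, ← Finset.sum_sub_distrib,
    Finset.mul_sum]
  refine Finset.sum_congr rfl fun l _ => ?_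
  simp only [Pi.smul_apply, smul_eq_mul, map_mul, Complex.conj_I]
  linear_combination (-(1 / 2) * dz l f (s x) * fderiv ℂ s x (Pi.single j 1) l +
    (1 / 2) * dzbar l f (s x) * conj (fderiv ℂ s x (Pi.single j 1) l)) * Complex.I_sq

/-- Chain rule for `∂/∂z̄_j` along a holomorphic map. -/
theorem dzbar_comp_of_differentiableAt {f : (ι → ℂ) → ℂ} {s : (κ → ℂ) → ι → ℂ} {x : κ → ℂ}
    (hf : DifferentiableAt ℝ f (s x)) (hs : DifferentiableAt ℂ s x) (j : κ) :
    dzbar j (fun y => f (s y)) x =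
      ∑ l, dzbar l f (s x) * conj (fderiv ℂ s x (Pi.single j 1) l) := by
  rw [dzbar, fderiv_comp_of_differentiableAt hf hs, fderiv_comp_of_differentiableAt hf hs, single_I,
    map_smul, fderiv_eq_sum, fderiv_eq_sum, Finset.mul_sum, ← Finset.sum_add_distrib,
    Finset.mul_sum]
  refine Finset.sum_congr rfl fun l _ => ?_
  simp only [Pi.smul_apply, smul_eq_mul, map_mul, Complex.conj_I]
  linear_combination ((1 / 2) * dz l f (s x) * fderiv ℂ s x (Pi.single j 1) l -
    (1 / 2) * dzbar l f (s x) * conj (fderiv ℂ s x (Pi.single j 1) l)) * Complex.I_sq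

theorem contDiffOn_fderiv_apply {U : Set (ι → ℂ)} {f : (ι → ℂ) → ℂ} (hU : IsOpen U)
    (hf : ContDiffOn ℝ ∞ f U) (v : ι → ℂ) : ContDiffOn ℝ ∞ (fun x => fderiv ℝ f x v) U :=
  (hf.fderiv_of_isOpen hU (by simp)).clm_apply contDiffOn_const

theorem contDiffOn_dz {U : Set (ι → ℂ)} {f : (ι → ℂ) → ℂ} (hU : IsOpen U)
    (hf : ContDiffOn ℝ ∞ f U) (j : ι) : ContDiffOn ℝ ∞ (dz j f) U :=
  contDiffOn_const.mul ((contDiffOn_fderiv_apply hU hf _).sub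
    (contDiffOn_const.mul (contDiffOn_fderiv_apply hU hf _)))

theorem contDiffOn_dzbar {U : Set (ι → ℂ)} {f : (ι → ℂ) → ℂ} (hU : IsOpen U)
    (hf : ContDiffOn ℝ ∞ f U) (j : ι) : ContDiffOn ℝ ∞ (dzbar j f) U :=
  contDiffOn_const.mul ((contDiffOn_fderiv_apply hU hf _).add
    (contDiffOn_const.mul (contDiffOn_fderiv_apply hU hf _)))

theorem differentiableAt_of_contDiffOn {U : Set (ι → ℂ)} {f : (ι → ℂ) → ℂ} (hU : IsOpen U)
    (hf : ContDiffOn ℝ ∞ f U) {x : ι → ℂ} (hx : x ∈ U) : DifferentiableAt ℝ f x :=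
  (hf.contDiffAt (hU.mem_nhds hx)).differentiableAt (by simp)

theorem fderiv_fderiv_comm {U : Set (ι → ℂ)} {f : (ι → ℂ) → ℂ} (hU : IsOpen U)
    (hf : ContDiffOn ℝ ∞ f U) {x : ι → ℂ} (hx : x ∈ U) (a b : ι → ℂ) :
    fderiv ℝ (fun y => fderiv ℝ f y a) x b = fderiv ℝ (fun y => fderiv ℝ f y b) x a := by
  have hf' : DifferentiableAt ℝ (fderiv ℝ f) x :=
    ((hf.fderiv_of_isOpen hU (m := ∞) (by simp)).contDiffAt (hU.mem_nhds hx)).differentiableAt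
      (by simp)
  have h : ∀ a b : ι → ℂ, fderiv ℝ (fun y => fderiv ℝ f y a) x b = fderiv ℝ (fderiv ℝ f) x b a := by
    intro a b
    rw [(hf'.hasFDerivAt.clm_apply (hasFDerivAt_const a x)).fderiv]
    simp
  rw [h, h]
  exact ((hf.contDiffAt (hU.mem_nhds hx)).isSymmSndFDerivAt
    (by simpa using WithTop.coe_le_coe.2 (le_top : (2 : ℕ∞) ≤ ⊤))) b a

theorem dz_dz_comm {U : Set (ι → ℂ)} {f : (ι → ℂ) → ℂ} (hU : IsOpen U)
    (hf : ContDiffOn ℝ ∞ f U) {x : ι → ℂ} (hx : x ∈ U) (i j : ι) :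
    dz i (dz j f) x = dz j (dz i f) x := by
  have hd : ∀ v, DifferentiableAt ℝ (fun y => fderiv ℝ f y v) x := fun v =>
    differentiableAt_of_contDiffOn hU (contDiffOn_fderiv_apply hU hf v) hx
  have h : ∀ j w, fderiv ℝ (dz j f) x w =
      1 / 2 * (fderiv ℝ (fun y => fderiv ℝ f y (Pi.single j 1)) x w -
        Complex.I * fderiv ℝ (fun y => fderiv ℝ f y (Pi.single j Complex.I)) x w) := by
    intro j w
    have := (((hd (Pi.single j 1)).hasFDerivAt.fun_sub
      ((hd (Pi.single j Complex.I)).hasFDerivAt.const_mul Complex.I)).const_mul (1 / 2 : ℂ)).fderiv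
    rw [show dz j f = fun y => (1 / 2 : ℂ) * (fderiv ℝ f y (Pi.single j 1) -
      Complex.I * fderiv ℝ f y (Pi.single j Complex.I)) from rfl, this]
    rfl
  rw [dz, dz, h, h, h, h, fderiv_fderiv_comm hU hf hx (Pi.single j 1) (Pi.single i 1),
    fderiv_fderiv_comm hU hf hx (Pi.single j 1) (Pi.single i Complex.I),
    fderiv_fderiv_comm hU hf hx (Pi.single j Complex.I) (Pi.single i 1),
    fderiv_fderiv_comm hU hf hx (Pi.single j Complex.I) (Pi.single i Complex.I)]
  ring

theorem dz_dzbar_comm {U : Set (ι → ℂ)} {f : (ι → ℂ) → ℂ} (hU : IsOpen U)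
    (hf : ContDiffOn ℝ ∞ f U) {x : ι → ℂ} (hx : x ∈ U) (i j : ι) :
    dz i (dzbar j f) x = dzbar j (dz i f) x := by
  have hd : ∀ v, DifferentiableAt ℝ (fun y => fderiv ℝ f y v) x := fun v =>
    differentiableAt_of_contDiffOn hU (contDiffOn_fderiv_apply hU hf v) hx
  have h : ∀ w, fderiv ℝ (dz i f) x w =
      1 / 2 * (fderiv ℝ (fun y => fderiv ℝ f y (Pi.single i 1)) x w -
        Complex.I * fderiv ℝ (fun y => fderiv ℝ f y (Pi.single i Complex.I)) x w) := by
    intro w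
    have := (((hd (Pi.single i 1)).hasFDerivAt.fun_sub
      ((hd (Pi.single i Complex.I)).hasFDerivAt.const_mul Complex.I)).const_mul (1 / 2 : ℂ)).fderiv
    rw [show dz i f = fun y => (1 / 2 : ℂ) * (fderiv ℝ f y (Pi.single i 1) -
      Complex.I * fderiv ℝ f y (Pi.single i Complex.I)) from rfl, this]
    rfl
  have h' : ∀ w, fderiv ℝ (dzbar j f) x w =
      1 / 2 * (fderiv ℝ (fun y => fderiv ℝ f y (Pi.single j 1)) x w +
        Complex.I * fderiv ℝ (fun y => fderiv ℝ f y (Pi.single j Complex.I)) x w) := by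
    intro w
    have := (((hd (Pi.single j 1)).hasFDerivAt.fun_add
      ((hd (Pi.single j Complex.I)).hasFDerivAt.const_mul Complex.I)).const_mul (1 / 2 : ℂ)).fderiv
    rw [show dzbar j f = fun y => (1 / 2 : ℂ) * (fderiv ℝ f y (Pi.single j 1) +
      Complex.I * fderiv ℝ f y (Pi.single j Complex.I)) from rfl, this]
    rfl
  rw [dz, dzbar, h, h, h', h', fderiv_fderiv_comm hU hf hx (Pi.single j 1) (Pi.single i 1),
    fderiv_fderiv_comm hU hf hx (Pi.single j 1) (Pi.single i Complex.I),
    fderiv_fderiv_comm hU hf hx (Pi.single j Complex.I) (Pi.single i 1),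
    fderiv_fderiv_comm hU hf hx (Pi.single j Complex.I) (Pi.single i Complex.I)]
  ring

section Potential

variable {U : Set (ι → ℂ)} {φ : (ι → ℂ) → ℝ}

theorem contDiffOn_ofReal_comp (hφ : ContDiffOn ℝ ∞ φ U) :
    ContDiffOn ℝ ∞ (fun y => (φ y : ℂ)) U :=
  Complex.ofRealCLM.contDiff.comp_contDiffOn hφ

theorem contDiffOn_metricOfPotential (hU : IsOpen U) (hφ : ContDiffOn ℝ ∞ φ U) (j k : ι) :
    ContDiffOn ℝ ∞ (fun x => metricOfPotential φ x j k) U :=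
  contDiffOn_dz hU (contDiffOn_dzbar hU (contDiffOn_ofReal_comp hφ) k) j

theorem isHermitian_metricOfPotential (hU : IsOpen U) (hφ : ContDiffOn ℝ ∞ φ U) {x : ι → ℂ}
    (hx : x ∈ U) : (metricOfPotential φ x).IsHermitian := by
  have hc := contDiffOn_ofReal_comp hφ
  refine Matrix.IsHermitian.ext fun i j => ?_
  simp only [metricOfPotential, Matrix.of_apply, Complex.star_def]
  rw [← dzbar_conj (differentiableAt_of_contDiffOn hU (contDiffOn_dzbar hU hc i) hx),
    dz_dzbar_comm hU hc hx i j]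
  refine dzbar_congr (Filter.eventually_of_mem (hU.mem_nhds hx) fun y hy => ?_) j
  rw [← dz_conj (differentiableAt_of_contDiffOn hU hc hy)]
  simp only [Complex.conj_ofReal]

/-- A metric given by a smooth potential is Kähler as soon as it is positive definite. -/
theorem isKahlerMetricOn_metricOfPotential (hU : IsOpen U) (hφ : ContDiffOn ℝ ∞ φ U)
    (hpos : ∀ x ∈ U, (metricOfPotential φ x).PosDef) :
    IsKahlerMetricOn U (metricOfPotential φ) :=
  ⟨contDiffOn_metricOfPotential hU hφ, hpos, fun _ hx i j k =>
    dz_dz_comm hU (contDiffOn_dzbar hU (contDiffOn_ofReal_comp hφ) k) hx i j⟩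

end Potential

end WirtingerCalculus

/-! ### The Levi form of the squared norm of a holomorphic map -/

section LeviForm

set_option linter.unusedSectionVars false

open scoped Topology ComplexConjugate

variable {ι : Type*} [Fintype ι] [DecidableEq ι]
  {H : Type*} [NormedAddCommGroup H] [InnerProductSpace ℂ H] [CompleteSpace H]

/-- The Riesz isomorphism of a Hilbert space with its dual, which is antilinear, as a real-linear
map. -/
noncomputable def rieszRepr : StrongDual ℂ H →L[ℝ] H where
  toFun φ := (InnerProductSpace.toDual ℂ H).symm φ
  map_add' := map_add _
  map_smul' r φ := by
    have h := (InnerProductSpace.toDual ℂ H).symm.map_smulₛₗ (r : ℂ) φ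
    simpa using h
  cont := (InnerProductSpace.toDual ℂ H).symm.continuous

theorem inner_rieszRepr (φ : StrongDual ℂ H) (x : H) : inner ℂ (rieszRepr φ) x = φ x := by
  simp [rieszRepr]

theorem norm_rieszRepr (φ : StrongDual ℂ H) : ‖rieszRepr φ‖ = ‖φ‖ :=
  (InnerProductSpace.toDual ℂ H).symm.norm_map φ

theorem rieszRepr_smul (c : ℂ) (φ : StrongDual ℂ H) :
    rieszRepr (c • φ) = conj c • rieszRepr φ :=
  (InnerProductSpace.toDual ℂ H).symm.map_smulₛₗ c φ

theorem apply_rieszRepr_self (φ : StrongDual ℂ H) : φ (rieszRepr φ) = ((‖φ‖ ^ 2 : ℝ) : ℂ) := by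
  rw [← inner_rieszRepr, inner_self_eq_norm_sq_to_K, norm_rieszRepr]
  simp

theorem conj_apply_rieszRepr (φ ψ : StrongDual ℂ H) :
    conj (φ (rieszRepr ψ)) = ψ (rieszRepr φ) := by
  rw [← inner_rieszRepr, ← inner_rieszRepr, inner_conj_symm]

theorem hasFDerivAt_apply_rieszRepr {Φ Ψ : (ι → ℂ) → StrongDual ℂ H} {x : ι → ℂ}
    (hΨ : DifferentiableAt ℂ Ψ x) (hΦ : DifferentiableAt ℂ Φ x) :
    DifferentiableAt ℝ (fun y => Ψ y (rieszRepr (Φ y))) x ∧ ∀ v,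
      fderiv ℝ (fun y => Ψ y (rieszRepr (Φ y))) x v =
        fderiv ℂ Ψ x v (rieszRepr (Φ x)) + Ψ x (rieszRepr (fderiv ℂ Φ x v)) := by
  have h1 : HasFDerivAt (fun y => (Ψ y).restrictScalars ℝ)
      ((ContinuousLinearMap.restrictScalarsL ℂ H ℂ ℝ ℝ).comp
        ((fderiv ℂ Ψ x).restrictScalars ℝ)) x :=
    (ContinuousLinearMap.restrictScalarsL ℂ H ℂ ℝ ℝ).hasFDerivAt.comp x
      (hΨ.hasFDerivAt.restrictScalars ℝ)
  have h2 : HasFDerivAt (fun y => rieszRepr (Φ y))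
      ((rieszRepr (H := H)).comp ((fderiv ℂ Φ x).restrictScalars ℝ)) x :=
    (rieszRepr (H := H)).hasFDerivAt.comp x (hΦ.hasFDerivAt.restrictScalars ℝ)
  have h := h1.clm_apply h2
  refine ⟨h.differentiableAt, fun v => ?_⟩
  rw [show (fun y => Ψ y (rieszRepr (Φ y))) =
    fun y => ((Ψ y).restrictScalars ℝ) (rieszRepr (Φ y)) from rfl, h.fderiv]
  simp [add_comm]

theorem dz_apply_rieszRepr {Φ Ψ : (ι → ℂ) → StrongDual ℂ H} {x : ι → ℂ}
    (hΨ : DifferentiableAt ℂ Ψ x) (hΦ : DifferentiableAt ℂ Φ x) (j : ι) :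
    dz j (fun y => Ψ y (rieszRepr (Φ y))) x =
      fderiv ℂ Ψ x (Pi.single j 1) (rieszRepr (Φ x)) := by
  rw [dz, (hasFDerivAt_apply_rieszRepr hΨ hΦ).2, (hasFDerivAt_apply_rieszRepr hΨ hΦ).2, single_I]
  simp only [map_smul, rieszRepr_smul, Complex.conj_I, smul_apply, smul_eq_mul]
  linear_combination (-(1 / 2) * fderiv ℂ Ψ x (Pi.single j 1) (rieszRepr (Φ x)) +
    1 / 2 * Ψ x (rieszRepr (fderiv ℂ Φ x (Pi.single j 1)))) * Complex.I_sq

theorem dzbar_apply_rieszRepr {Φ Ψ : (ι → ℂ) → StrongDual ℂ H} {x : ι → ℂ}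
    (hΨ : DifferentiableAt ℂ Ψ x) (hΦ : DifferentiableAt ℂ Φ x) (j : ι) :
    dzbar j (fun y => Ψ y (rieszRepr (Φ y))) x =
      Ψ x (rieszRepr (fderiv ℂ Φ x (Pi.single j 1))) := by
  rw [dzbar, (hasFDerivAt_apply_rieszRepr hΨ hΦ).2, (hasFDerivAt_apply_rieszRepr hΨ hΦ).2, single_I]
  simp only [map_smul, rieszRepr_smul, Complex.conj_I, smul_apply, smul_eq_mul]
  linear_combination ((1 / 2) * fderiv ℂ Ψ x (Pi.single j 1) (rieszRepr (Φ x)) -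
    1 / 2 * Ψ x (rieszRepr (fderiv ℂ Φ x (Pi.single j 1)))) * Complex.I_sq

variable {U : Set (ι → ℂ)} {Φ : (ι → ℂ) → StrongDual ℂ H} {κ : (ι → ℂ) → ℝ}

theorem contDiffOn_of_eq_norm_sq (hU : IsOpen U) (hΦ : DifferentiableOn ℂ Φ U)
    (hκ : ∀ x ∈ U, κ x = ‖Φ x‖ ^ 2) : ContDiffOn ℝ ∞ κ U := by
  have h1 : ContDiffOn ℝ ∞ Φ U := (contDiffOn_of_differentiableOn hU hΦ).restrict_scalars ℝ
  have h2 : ContDiffOn ℝ ∞ (fun y => rieszRepr (Φ y)) U :=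
    (rieszRepr (H := H)).contDiff.comp_contDiffOn h1
  refine (h2.norm_sq ℂ).congr fun x hx => ?_
  rw [hκ x hx, norm_rieszRepr]

/-- The Levi form of `log ‖Φ‖²` for a holomorphic map `Φ` into a Hilbert space. -/
theorem metricOfPotential_log_norm_sq (hU : IsOpen U) (hΦ : DifferentiableOn ℂ Φ U)
    (hκ : ∀ x ∈ U, κ x = ‖Φ x‖ ^ 2) (h0 : ∀ x ∈ U, Φ x ≠ 0) {x : ι → ℂ} (hx : x ∈ U) (j k : ι) :
    metricOfPotential (fun y => Real.log (κ y)) x j k =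
      (κ x : ℂ)⁻¹ * fderiv ℂ Φ x (Pi.single j 1) (rieszRepr (fderiv ℂ Φ x (Pi.single k 1))) -
      (κ x : ℂ)⁻¹ ^ 2 * (fderiv ℂ Φ x (Pi.single j 1) (rieszRepr (Φ x)) *
        Φ x (rieszRepr (fderiv ℂ Φ x (Pi.single k 1)))) := by
  have hd : ∀ y ∈ U, DifferentiableAt ℂ Φ y := fun y hy => hΦ.differentiableAt (hU.mem_nhds hy)
  have hd' : DifferentiableAt ℂ (fun y => fderiv ℂ Φ y (Pi.single k 1)) x :=
    (differentiableOn_fderiv_apply hU hΦ _).differentiableAt (hU.mem_nhds hx)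
  have hκ' : ∀ y ∈ U, (κ y : ℂ) = Φ y (rieszRepr (Φ y)) := fun y hy => by
    rw [apply_rieszRepr_self, hκ y hy]
  have hpos : ∀ y ∈ U, 0 < κ y := fun y hy => by
    rw [hκ y hy]
    have := norm_pos_iff.2 (h0 y hy)
    positivity
  have hdκ : ∀ y ∈ U, DifferentiableAt ℝ (fun y => Φ y (rieszRepr (Φ y))) y := fun y hy =>
    (hasFDerivAt_apply_rieszRepr (hd y hy) (hd y hy)).1
  have hne : ∀ y ∈ U, Φ y (rieszRepr (Φ y)) ≠ 0 := fun y hy => by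
    rw [← hκ' y hy]
    exact_mod_cast (hpos y hy).ne'
  have e1 : ∀ y ∈ U, dzbar k (fun y => ((Real.log (κ y) : ℝ) : ℂ)) y =
      (Φ y (rieszRepr (Φ y)))⁻¹ * Φ y (rieszRepr (fderiv ℂ Φ y (Pi.single k 1))) := by
    intro y hy
    rw [← dzbar_apply_rieszRepr (hd y hy) (hd y hy), ← dzbar_comp (g := Complex.log) (hdκ y hy)]
    · refine dzbar_congr (Filter.eventually_of_mem (hU.mem_nhds hy) fun z hz => ?_) k
      rw [Complex.ofReal_log (hpos z hz).le, hκ' z hz]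
    · refine Complex.hasDerivAt_log ?_
      rw [← hκ' y hy]
      exact Complex.ofReal_mem_slitPlane.2 (hpos y hy)
  rw [metricOfPotential, Matrix.of_apply,
    dz_congr (Filter.eventually_of_mem (hU.mem_nhds hx) e1) j]
  have hinv := hasDerivAt_inv (hne x hx)
  have hdinv : DifferentiableAt ℝ (fun y => (Φ y (rieszRepr (Φ y)))⁻¹) x := (hdκ x hx).inv (hne x hx)
  rw [dz_mul hdinv (hasFDerivAt_apply_rieszRepr (hd x hx) hd').1,
    dz_comp (hdκ x hx) hinv, dz_apply_rieszRepr (hd x hx) (hd x hx),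
    dz_apply_rieszRepr (hd x hx) hd', ← hκ' x hx]
  ring

/-- The Levi form of `log ‖Φ‖²` is positive definite where the derivative of `Φ` in no direction is
parallel to `Φ`: this is the equality case of the Cauchy–Schwarz inequality. -/
theorem posDef_metricOfPotential_log_norm_sq (hU : IsOpen U) (hΦ : DifferentiableOn ℂ Φ U)
    (hκ : ∀ x ∈ U, κ x = ‖Φ x‖ ^ 2) (h0 : ∀ x ∈ U, Φ x ≠ 0)
    (hnd : ∀ x ∈ U, ∀ v : ι → ℂ, ∀ c : ℂ, fderiv ℂ Φ x v = c • Φ x → v = 0)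
    {x : ι → ℂ} (hx : x ∈ U) : (metricOfPotential (fun y => Real.log (κ y)) x).PosDef := by
  have hpos : ∀ y ∈ U, 0 < κ y := fun y hy => by
    rw [hκ y hy]
    have := norm_pos_iff.2 (h0 y hy)
    positivity
  refine Matrix.posDef_iff_dotProduct_mulVec.2 ⟨isHermitian_metricOfPotential hU
    ((contDiffOn_of_eq_norm_sq hU hΦ hκ).log fun y hy => (hpos y hy).ne') hx, fun v hv => ?_⟩
  set A : StrongDual ℂ H := fderiv ℂ Φ x (star v) with hA
  have hsum : A = ∑ j, conj (v j) • fderiv ℂ Φ x (Pi.single j 1) := by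
    rw [hA]
    conv_lhs => rw [← Finset.univ_sum_single (star v), map_sum]
    refine Finset.sum_congr rfl fun j _ => ?_
    rw [← map_smul, ← Pi.single_smul]
    simp
  have hR : rieszRepr A = ∑ k, v k • rieszRepr (fderiv ℂ Φ x (Pi.single k 1)) := by
    rw [hsum, map_sum]
    exact Finset.sum_congr rfl fun k _ => by rw [rieszRepr_smul, Complex.conj_conj]
  have hval : star v ⬝ᵥ (metricOfPotential (fun y => Real.log (κ y)) x).mulVec v =
      (κ x : ℂ)⁻¹ * A (rieszRepr A) - (κ x : ℂ)⁻¹ ^ 2 *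
        (A (rieszRepr (Φ x)) * Φ x (rieszRepr A)) := by
    have e1 : A (rieszRepr A) = ∑ j, ∑ k, conj (v j) * v k *
        fderiv ℂ Φ x (Pi.single j 1) (rieszRepr (fderiv ℂ Φ x (Pi.single k 1))) := by
      rw [hR, map_sum, Finset.sum_comm]
      refine Finset.sum_congr rfl fun k _ => ?_
      rw [hsum, map_smul, sum_apply, smul_eq_mul, Finset.mul_sum]
      refine Finset.sum_congr rfl fun j _ => ?_
      rw [smul_apply, smul_eq_mul]
      ring
    have e2 : A (rieszRepr (Φ x)) * Φ x (rieszRepr A) = ∑ j, ∑ k, conj (v j) * v k *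
        (fderiv ℂ Φ x (Pi.single j 1) (rieszRepr (Φ x)) *
          Φ x (rieszRepr (fderiv ℂ Φ x (Pi.single k 1)))) := by
      rw [hR, map_sum, hsum, sum_apply, Finset.sum_mul_sum]
      refine Finset.sum_congr rfl fun j _ => Finset.sum_congr rfl fun k _ => ?_
      rw [map_smul, smul_apply, smul_eq_mul, smul_eq_mul]
      ring
    rw [e1, e2, Finset.mul_sum, Finset.mul_sum, ← Finset.sum_sub_distrib, dotProduct]
    refine Finset.sum_congr rfl fun j _ => ?_
    rw [Matrix.mulVec, dotProduct, Finset.mul_sum, Finset.mul_sum, Finset.mul_sum,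
      ← Finset.sum_sub_distrib]
    refine Finset.sum_congr rfl fun k _ => ?_
    rw [metricOfPotential_log_norm_sq hU hΦ hκ h0 hx, Pi.star_apply, Complex.star_def]
    ring
  have hv' : star v ≠ 0 := star_ne_zero.2 hv
  have hA0 : A ≠ 0 := fun h => hv' (hnd x hx _ 0 (by rw [← hA, h]; exact (zero_smul ℂ (Φ x)).symm))
  have hcs : ‖A (rieszRepr (Φ x))‖ < ‖A‖ * ‖Φ x‖ := by
    rw [← inner_rieszRepr, ← norm_rieszRepr A, ← norm_rieszRepr (Φ x)]
    refine lt_of_le_of_ne (norm_inner_le_norm _ _) fun h => ?_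
    have hne : ∀ φ : StrongDual ℂ H, φ ≠ 0 → rieszRepr φ ≠ 0 := fun φ hφ => by
      rw [← norm_ne_zero_iff, norm_rieszRepr]
      exact norm_ne_zero_iff.2 hφ
    rw [norm_inner_symm, mul_comm, norm_inner_eq_norm_iff (hne _ (h0 x hx)) (hne _ hA0)] at h
    obtain ⟨r, -, hr⟩ := h
    have hsub : A - conj r • Φ x = 0 := by
      by_contra hcon
      refine hne _ hcon ?_
      rw [map_sub, rieszRepr_smul, Complex.conj_conj, hr, sub_self]
    exact hv' (hnd x hx _ _ (sub_eq_zero.1 hsub))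
  have hreal : star v ⬝ᵥ (metricOfPotential (fun y => Real.log (κ y)) x).mulVec v =
      (((‖A‖ * ‖Φ x‖) ^ 2 - ‖A (rieszRepr (Φ x))‖ ^ 2) / κ x ^ 2 : ℝ) := by
    have hκ0 : (κ x : ℂ) ≠ 0 := by exact_mod_cast (hpos x hx).ne'
    have e3 : Φ x (rieszRepr A) = conj (A (rieszRepr (Φ x))) := (conj_apply_rieszRepr _ _).symm
    rw [hval, e3, Complex.mul_conj, Complex.normSq_eq_norm_sq, apply_rieszRepr_self]
    have : (κ x : ℂ) = (‖Φ x‖ : ℂ) ^ 2 := by rw [hκ x hx]; push_cast; rfl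
    push_cast
    field_simp
    rw [this]
    ring
  rw [hreal]
  refine Complex.zero_lt_real.2 (div_pos ?_ (pow_pos (hpos x hx) 2))
  exact sub_pos.2 (pow_lt_pow_left₀ hcs (norm_nonneg _) two_ne_zero)

end LeviForm

/-! ### The mean value property over polydiscs -/

section BergmanSpace

open MeasureTheory Metric Set
open scoped Topology ComplexConjugate Real

variable {d : ℕ}

theorem measurePreserving_smul_of_norm_eq_one {c : ℂ} (hc : ‖c‖ = 1) :
    MeasurePreserving (fun y : Fin d → ℂ => c • y) volume volume := by
  have h : MeasurePreserving (fun z : ℂ => c * z) volume volume :=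
    (rotation ⟨c, by simp [Submonoid.unitSphere, hc]⟩).measurePreserving
  exact volume_preserving_pi (fun _ : Fin d => h)

/-- The mean value property over polydiscs: average the mean value property over the circles
`θ ↦ z + e^{iθ} y`, and use that the polydisc is invariant under rotations. -/
theorem setIntegral_closedBall_eq {U : Set (Fin d → ℂ)} {f : (Fin d → ℂ) → ℂ} (hU : IsOpen U)
    (hf : DifferentiableOn ℂ f U) {z : Fin d → ℂ} {r : ℝ} (hz : closedBall z r ⊆ U) :
    ∫ y in closedBall (0 : Fin d → ℂ) r, f (z + y) =
      volume.real (closedBall (0 : Fin d → ℂ) r) * f z := by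
  set B := closedBall (0 : Fin d → ℂ) r with hB
  have hmem : ∀ y ∈ B, ∀ c : ℂ, ‖c‖ ≤ 1 → z + c • y ∈ U := fun y hy c hc => hz <| by
    rw [mem_closedBall, dist_eq_norm, add_sub_cancel_left, norm_smul]
    rw [hB, mem_closedBall, dist_zero_right] at hy
    nlinarith [norm_nonneg y]
  have hc1 : ∀ θ, ‖circleMap 0 1 θ‖ = 1 := fun θ => by simp
  have hint : Integrable (Function.uncurry fun (θ : ℝ) (y : Fin d → ℂ) =>
      f (z + circleMap 0 1 θ • y))
      ((volume.restrict (Set.uIoc 0 (2 * π))).prod (volume.restrict B)) := by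
    rw [Measure.prod_restrict]
    have hcont : ContinuousOn (Function.uncurry fun (θ : ℝ) (y : Fin d → ℂ) =>
        f (z + circleMap 0 1 θ • y)) (Set.uIcc 0 (2 * π) ×ˢ B) := by
      refine hf.continuousOn.comp (f := fun p : ℝ × (Fin d → ℂ) => z + circleMap 0 1 p.1 • p.2)
        (by fun_prop) fun p hp => hmem p.2 hp.2 _ (hc1 _).le
    exact (hcont.integrableOn_compact (isCompact_uIcc.prod (isCompact_closedBall _ _))).mono_set
      (Set.prod_mono Set.uIoc_subset_uIcc subset_rfl)
  have hswap := intervalIntegral_integral_swap hint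
  have hL : ∀ θ : ℝ, ∫ y in B, f (z + circleMap 0 1 θ • y) = ∫ y in B, f (z + y) := by
    intro θ
    have hne : circleMap 0 1 θ ≠ 0 := norm_ne_zero_iff.1 (by rw [hc1]; exact one_ne_zero)
    have hpre : (fun y : Fin d → ℂ => circleMap 0 1 θ • y) ⁻¹' B = B := by
      ext y
      simp [hB, norm_smul]
    have h := (measurePreserving_smul_of_norm_eq_one (d := d) (hc1 θ)).setIntegral_preimage_emb
      (measurableEmbedding_const_smul₀ hne) (fun y => f (z + y)) B
    rwa [hpre] at h
  have hR : ∀ y ∈ B, ∫ θ in (0 : ℝ)..2 * π, f (z + circleMap 0 1 θ • y) = 2 * π * f z := by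
    intro y hy
    have hd : DiffContOnCl ℂ (fun ζ : ℂ => f (z + ζ • y)) (ball 0 |1|) := by
      refine DifferentiableOn.diffContOnCl ?_
      refine (differentiableOn_comp_line hU hf z y).mono fun ζ hζ => hmem y hy ζ ?_
      rw [abs_one, closure_ball _ one_ne_zero] at hζ
      simpa using hζ
    have h := hd.circleAverage
    rw [Real.circleAverage, zero_smul, add_zero, Complex.real_smul, Complex.ofReal_inv,
      inv_mul_eq_iff_eq_mul₀] at h
    · simpa using h
    · simp
  simp only [hL] at hswap
  rw [setIntegral_congr_fun measurableSet_closedBall hR, intervalIntegral.integral_const,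
    setIntegral_const, Complex.real_smul, Complex.real_smul] at hswap
  have hpi : (2 * π : ℂ) ≠ 0 := by simp
  have : (2 * π : ℂ) * ∫ y in B, f (z + y) = 2 * π * (volume.real B * f z) := by
    have := hswap
    push_cast at this
    linear_combination this
  exact mul_left_cancel₀ hpi this

/-- Square integrable holomorphic functions are bounded, at points at distance more than `r` from
the boundary, by a constant multiple of their `L²` norm. -/
theorem exists_norm_le_mul_norm {Ω : Set (Fin d → ℂ)} (hΩ : IsOpen Ω) {r : ℝ} (hr : 0 < r) :
    ∃ C : ℝ, 0 ≤ C ∧ ∀ z, closedBall z r ⊆ Ω → ∀ f : (Fin d → ℂ) → ℂ, DifferentiableOn ℂ f Ω →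
      ∀ F : Lp ℂ 2 (volume.restrict Ω), F =ᵐ[volume.restrict Ω] f → ‖f z‖ ≤ C * ‖F‖ := by
  set V := volume.real (closedBall (0 : Fin d → ℂ) r) with hV
  have hVpos : 0 < V := ENNReal.toReal_pos (measure_closedBall_pos _ _ hr).ne'
    (isCompact_closedBall _ _).measure_lt_top.ne
  refine ⟨V⁻¹ * V ^ (1 / (2 : ENNReal).toReal), by positivity, fun z hz f hf F hF => ?_⟩
  have hBm : MeasurableSet (closedBall z r) := measurableSet_closedBall
  have hBfin : (volume.restrict Ω) (closedBall z r) ≠ ⊤ :=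
    ((Measure.restrict_apply_le _ _).trans_lt (isCompact_closedBall _ _).measure_lt_top).ne
  have h1 : ∫ y in closedBall (0 : Fin d → ℂ) r, f (z + y) = ∫ y in closedBall z r, f y := by
    have h := (measurePreserving_add_left (volume : Measure (Fin d → ℂ)) z).setIntegral_preimage_emb
      (measurableEmbedding_addLeft z) f (closedBall z r)
    rw [preimage_add_closedBall] at h
    simpa using h
  have h2 : inner ℂ (indicatorConstLp 2 hBm hBfin (1 : ℂ)) F = ∫ y in closedBall z r, f y := by
    rw [L2.inner_indicatorConstLp_one, Measure.restrict_restrict hBm, inter_eq_left.2 hz]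
    refine integral_congr_ae ?_
    have := ae_restrict_of_ae_restrict_of_subset hz hF
    exact this
  have h3 : ‖indicatorConstLp 2 hBm hBfin (1 : ℂ)‖ = V ^ (1 / (2 : ENNReal).toReal) := by
    rw [norm_indicatorConstLp two_ne_zero ENNReal.ofNat_ne_top, norm_one, one_mul, hV]
    congr 1
    rw [measureReal_restrict_apply hBm, inter_eq_left.2 hz, measureReal_def, measureReal_def,
      Measure.addHaar_closedBall_center]
  have h4 := setIntegral_closedBall_eq hΩ hf hz
  rw [h1, ← h2, ← hV] at h4
  have h5 : V * ‖f z‖ ≤ V ^ (1 / (2 : ENNReal).toReal) * ‖F‖ := by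
    rw [← h3]
    calc V * ‖f z‖ = ‖(V : ℂ) * f z‖ := by rw [norm_mul, Complex.norm_real, Real.norm_of_nonneg hVpos.le]
      _ ≤ _ := by rw [← h4]; exact norm_inner_le_norm _ _
  rw [mul_assoc, ← div_eq_inv_mul, le_div_iff₀ hVpos]
  linarith

end BergmanSpace

/-! ### The Bergman space as a Hilbert space -/

section BergmanHilbertSpace

open MeasureTheory Metric Set
open scoped Topology ComplexConjugate Real

variable {d : ℕ}

theorem hasFDerivAt_of_norm_le_mul_sq {E G : Type*} [NormedAddCommGroup E] [NormedSpace ℂ E]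
    [NormedAddCommGroup G] [NormedSpace ℂ G] {Φ : E → G} {L : E →L[ℂ] G} {x : E} {C r : ℝ}
    (hr : 0 < r) (h : ∀ y, ‖y‖ < r → ‖Φ (x + y) - Φ x - L y‖ ≤ C * ‖y‖ ^ 2) :
    HasFDerivAt Φ L x := by
  rw [hasFDerivAt_iff_isLittleO_nhds_zero]
  refine Asymptotics.IsBigO.trans_isLittleO (g := fun y : E => ‖y‖ ^ 2) ?_
    (Asymptotics.isLittleO_norm_pow_id one_lt_two)
  refine Asymptotics.IsBigO.of_bound C ?_
  filter_upwards [ball_mem_nhds (0 : E) hr] with y hy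
  rw [norm_pow, norm_norm]
  exact h y (by simpa using hy)

/-- The Bergman space as a subspace of `L²(Ω)`: the classes with a holomorphic representative. -/
def bergmanL2 (Ω : Set (Fin d → ℂ)) : Submodule ℂ (Lp ℂ 2 (volume.restrict Ω)) where
  carrier := {F | ∃ f : (Fin d → ℂ) → ℂ, DifferentiableOn ℂ f Ω ∧ F =ᵐ[volume.restrict Ω] f}
  add_mem' := by
    rintro F G ⟨f, hf, hFf⟩ ⟨g, hg, hGg⟩
    exact ⟨f + g, hf.add hg, (Lp.coeFn_add F G).trans (hFf.add hGg)⟩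
  zero_mem' := ⟨0, differentiableOn_const 0, Lp.coeFn_zero ..⟩
  smul_mem' := by
    rintro c F ⟨f, hf, hFf⟩
    exact ⟨c • f, hf.const_smul c, (Lp.coeFn_smul c F).trans (hFf.const_smul c)⟩

/-- The Bergman space as an inner product space in its own right. -/
def BergmanHilbert (Ω : Set (Fin d → ℂ)) : Type := bergmanL2 Ω

noncomputable instance (Ω : Set (Fin d → ℂ)) : NormedAddCommGroup (BergmanHilbert Ω) :=
  inferInstanceAs (NormedAddCommGroup (bergmanL2 Ω))

noncomputable instance (Ω : Set (Fin d → ℂ)) : InnerProductSpace ℂ (BergmanHilbert Ω) :=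
  inferInstanceAs (InnerProductSpace ℂ (bergmanL2 Ω))

/-- The inclusion of the Bergman space in `L²(Ω)`. -/
noncomputable def bergmanIncl (Ω : Set (Fin d → ℂ)) :
    BergmanHilbert Ω →ₗᵢ[ℂ] Lp ℂ 2 (volume.restrict Ω) :=
  (bergmanL2 Ω).subtypeₗᵢ

theorem exists_rep {Ω : Set (Fin d → ℂ)} (F : BergmanHilbert Ω) :
    ∃ f : (Fin d → ℂ) → ℂ, DifferentiableOn ℂ f Ω ∧ bergmanIncl Ω F =ᵐ[volume.restrict Ω] f :=
  F.2

theorem exists_bergmanIncl_eq {Ω : Set (Fin d → ℂ)} {f : (Fin d → ℂ) → ℂ}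
    (hf : f ∈ bergmanSpace Ω) : ∃ F, bergmanIncl Ω F =ᵐ[volume.restrict Ω] f :=
  ⟨⟨hf.2.toLp f, f, hf.1, hf.2.coeFn_toLp⟩, hf.2.coeFn_toLp⟩

/-- `Φ z` is the evaluation at `z`, as a bounded functional on the Bergman space, for `z ∈ Ω`. -/
def IsEvaluation (Ω : Set (Fin d → ℂ)) (Φ : (Fin d → ℂ) → StrongDual ℂ (BergmanHilbert Ω)) : Prop :=
  ∀ z ∈ Ω, ∀ (F : BergmanHilbert Ω) (f : (Fin d → ℂ) → ℂ), DifferentiableOn ℂ f Ω →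
    bergmanIncl Ω F =ᵐ[volume.restrict Ω] f → Φ z F = f z

theorem eqOn_of_ae_eq {Ω : Set (Fin d → ℂ)} (hΩ : IsOpen Ω) {f g : (Fin d → ℂ) → ℂ}
    (hf : DifferentiableOn ℂ f Ω) (hg : DifferentiableOn ℂ g Ω)
    (h : f =ᵐ[volume.restrict Ω] g) : EqOn f g Ω :=
  Measure.eqOn_open_of_ae_eq h hΩ hf.continuousOn hg.continuousOn

theorem exists_isEvaluation {Ω : Set (Fin d → ℂ)} (hΩ : IsOpen Ω) :
    ∃ Φ, IsEvaluation Ω Φ := by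
  choose f hf hF using exists_rep (Ω := Ω)
  have key : ∀ z ∈ Ω, ∃ φ : StrongDual ℂ (BergmanHilbert Ω), ∀ F, φ F = f F z := by
    intro z hz
    obtain ⟨r, hr, hrΩ⟩ := nhds_basis_closedBall.mem_iff.1 (hΩ.mem_nhds hz)
    obtain ⟨C, -, hC⟩ := exists_norm_le_mul_norm hΩ hr
    refine ⟨LinearMap.mkContinuous ⟨⟨fun F => f F z, fun F G => ?_⟩, fun c F => ?_⟩ C fun F => ?_,
      fun F => rfl⟩
    · refine eqOn_of_ae_eq hΩ (hf _) ((hf F).add (hf G)) ?_ hz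
      exact (hF _).symm.trans ((Lp.coeFn_add _ _).trans ((hF F).add (hF G)))
    · refine eqOn_of_ae_eq hΩ (hf _) ((hf F).const_smul c) ?_ hz
      exact (hF _).symm.trans ((Lp.coeFn_smul _ _).trans ((hF F).const_smul c))
    · exact hC z hrΩ (f F) (hf F) _ (hF F)
  classical
  choose! Φ hΦ using key
  refine ⟨Φ, fun z hz F g hg hFg => ?_⟩
  rw [hΦ z hz]
  exact eqOn_of_ae_eq hΩ (hf F) hg ((hF F).symm.trans hFg) hz

variable {Ω : Set (Fin d → ℂ)} {Φ : (Fin d → ℂ) → StrongDual ℂ (BergmanHilbert Ω)}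

theorem IsEvaluation.differentiableOn_apply (hΦ : IsEvaluation Ω Φ) (F : BergmanHilbert Ω) :
    DifferentiableOn ℂ (fun z => Φ z F) Ω := by
  obtain ⟨f, hf, hF⟩ := exists_rep F
  exact hf.congr fun z hz => hΦ z hz F f hf hF

theorem IsEvaluation.ae_eq (hΩ : IsOpen Ω) (hΦ : IsEvaluation Ω Φ) (F : BergmanHilbert Ω) :
    bergmanIncl Ω F =ᵐ[volume.restrict Ω] fun z => Φ z F := by
  obtain ⟨f, hf, hF⟩ := exists_rep F
  refine hF.trans ?_
  filter_upwards [ae_restrict_mem hΩ.measurableSet] with z hz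
  exact (hΦ z hz F f hf hF).symm

/-- The evaluation functional depends holomorphically on the point, in operator norm: the second
order Taylor estimate is uniform over the unit ball of the Bergman space. -/
theorem IsEvaluation.differentiableOn (hΩ : IsOpen Ω) (hΦ : IsEvaluation Ω Φ) :
    DifferentiableOn ℂ Φ Ω := by
  intro x hx
  obtain ⟨r, hr, hrΩ⟩ := nhds_basis_closedBall.mem_iff.1 (hΩ.mem_nhds hx)
  obtain ⟨C, hC0, hC⟩ := exists_norm_le_mul_norm hΩ (half_pos hr)
  have hr2 : 0 < r / 2 := half_pos hr
  have hball : ball x (r / 2) ⊆ Ω :=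
    (ball_subset_closedBall.trans (closedBall_subset_closedBall (by linarith))).trans hrΩ
  have hbound : ∀ F : BergmanHilbert Ω, ∀ z ∈ ball x (r / 2), ‖Φ z F‖ ≤ C * ‖F‖ := by
    intro F z hz
    refine hC z ?_ (fun z => Φ z F) (hΦ.differentiableOn_apply F) _ (hΦ.ae_eq hΩ F)
    refine (closedBall_subset_closedBall' ?_).trans hrΩ
    linarith [mem_ball.1 hz]
  have hd : ∀ F : BergmanHilbert Ω, DifferentiableOn ℂ (fun z => Φ z F) (ball x (r / 2)) := fun F =>
    (hΦ.differentiableOn_apply F).mono hball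
  have hdx : ∀ F : BergmanHilbert Ω, DifferentiableAt ℂ (fun z => Φ z F) x := fun F =>
    (hd F).differentiableAt (ball_mem_nhds x hr2)
  -- The derivative, as a bilinear map.
  let L : (Fin d → ℂ) →L[ℂ] StrongDual ℂ (BergmanHilbert Ω) :=
    LinearMap.mkContinuous₂
      (LinearMap.mk₂ ℂ (fun y F => fderiv ℂ (fun z => Φ z F) x y)
        (fun y y' F => map_add _ y y') (fun c y F => map_smul _ c y)
        (fun y F G => by
          simp only [map_add]
          rw [fderiv_fun_add (hdx F) (hdx G)]; rfl)
        (fun c y F => by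
          simp only [map_smul]
          rw [fderiv_fun_const_smul (hdx F)]; rfl))
      (2 * C / (r / 2)) (fun y F => by
        have h := norm_fderiv_le_of_norm_le hr2 (hd F) (hbound F)
        calc ‖fderiv ℂ (fun z => Φ z F) x y‖ ≤ 2 * (C * ‖F‖) / (r / 2) * ‖y‖ :=
              ((fderiv ℂ (fun z => Φ z F) x).le_opNorm y).trans
                (mul_le_mul_of_nonneg_right h (norm_nonneg _))
          _ = 2 * C / (r / 2) * ‖y‖ * ‖F‖ := by ring)
  have hL : ∀ y F, L y F = fderiv ℂ (fun z => Φ z F) x y := fun y F => rfl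
  refine HasFDerivAt.differentiableAt (f' := L) ?_ |>.differentiableWithinAt
  refine hasFDerivAt_of_norm_le_mul_sq (C := 4 * C / (r / 2) ^ 2) hr2 fun y hy => ?_
  refine ContinuousLinearMap.opNorm_le_bound _ (by positivity) fun F => ?_
  have h := norm_taylor_remainder_le hr2 (hd F) (hbound F) hy
  rw [sub_apply, sub_apply, hL]
  refine h.trans (le_of_eq ?_)
  rw [div_pow]
  ring

/-- The derivative of the evaluation map is the evaluation of derivatives. -/
theorem IsEvaluation.fderiv_apply (hΩ : IsOpen Ω) (hΦ : IsEvaluation Ω Φ) {x : Fin d → ℂ}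
    (hx : x ∈ Ω) (v : Fin d → ℂ) {F : BergmanHilbert Ω} {f : (Fin d → ℂ) → ℂ}
    (hf : DifferentiableOn ℂ f Ω) (hF : bergmanIncl Ω F =ᵐ[volume.restrict Ω] f) :
    fderiv ℂ Φ x v F = fderiv ℂ f x v := by
  have h1 : (fun z => Φ z F) =ᶠ[𝓝 x] f :=
    Filter.eventually_of_mem (hΩ.mem_nhds hx) fun z hz => hΦ z hz F f hf hF
  rw [← h1.fderiv_eq]
  have h2 := (hΦ.differentiableOn hΩ).differentiableAt (hΩ.mem_nhds hx)
  rw [(h2.hasFDerivAt.clm_apply (hasFDerivAt_const F x)).fderiv]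
  simp

/-- The Bergman space is complete. A Cauchy sequence `F_n` defines functionals `φ ↦ φ F_n` on the
dual, which converge in norm to some `e`; then `z ↦ e (Φ z)` is holomorphic and is the limit. -/
theorem IsEvaluation.completeSpace (hΩ : IsOpen Ω) (hΦ : IsEvaluation Ω Φ) :
    CompleteSpace (BergmanHilbert Ω) := by
  have hclosed : IsClosed (bergmanL2 Ω : Set (Lp ℂ 2 (volume.restrict Ω))) := by
    refine isSeqClosed_iff_isClosed.1 fun F G hF hFG => ?_
    let F' : ℕ → BergmanHilbert Ω := fun n => ⟨F n, hF n⟩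
    have hcau : CauchySeq F' := by
      have h := Metric.cauchySeq_iff.1 hFG.cauchySeq
      exact Metric.cauchySeq_iff.2 h
    have hlip := ContinuousLinearMap.lipschitz (E := BergmanHilbert Ω)
      (F := StrongDual ℂ (StrongDual ℂ (BergmanHilbert Ω))) (σ₁₂ := RingHom.id ℂ)
      (NormedSpace.inclusionInDoubleDual ℂ (BergmanHilbert Ω))
    obtain ⟨e, he⟩ := cauchySeq_tendsto_of_complete (hlip.cauchySeq_comp hcau)
    refine ⟨fun z => e (Φ z), e.differentiable.comp_differentiableOn (hΦ.differentiableOn hΩ), ?_⟩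
    obtain ⟨ns, hns, hae⟩ := (tendstoInMeasure_of_tendsto_Lp hFG).exists_seq_tendsto_ae
    have hall : ∀ᵐ z ∂volume.restrict Ω, ∀ n, F n z = Φ z (F' n) :=
      ae_all_iff.2 fun n => hΦ.ae_eq hΩ (F' n)
    filter_upwards [hae, hall] with z hz hz'
    refine tendsto_nhds_unique hz ?_
    have h1 : Filter.Tendsto (fun n => Φ z (F' n)) Filter.atTop (𝓝 (e (Φ z))) :=
      ((ContinuousLinearMap.apply ℂ ℂ (Φ z)).continuous.tendsto e).comp he
    exact (h1.comp hns.tendsto_atTop).congr fun i => (hz' _).symm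
  exact (hclosed.completeSpace_coe : CompleteSpace (bergmanL2 Ω))

end BergmanHilbertSpace

/-! ### The Bergman kernel on the diagonal -/

section BergmanKernel

open MeasureTheory Metric Set
open scoped Topology ComplexConjugate Real

variable {d : ℕ} {Ω : Set (Fin d → ℂ)}

/-- The integral pairing of the Bergman space in terms of representatives. -/
theorem inner_bergmanHilbert {F G : BergmanHilbert Ω} {f g : (Fin d → ℂ) → ℂ}
    (hF : bergmanIncl Ω F =ᵐ[volume.restrict Ω] f) (hG : bergmanIncl Ω G =ᵐ[volume.restrict Ω] g) :
    inner ℂ G F = ∫ z in Ω, f z * conj (g z) := by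
  rw [← (bergmanIncl Ω).inner_map_map, L2.inner_def]
  refine integral_congr_ae ?_
  filter_upwards [hF, hG] with z hf hg
  rw [hf, hg, RCLike.inner_apply]

/-- Riesz representation of the point evaluations gives the Bergman kernel. -/
theorem isBergmanKernel_bergmanKernel (hΩ : IsOpen Ω) :
    IsBergmanKernel Ω (bergmanKernel Ω) := by
  obtain ⟨Φ, hΦ⟩ := exists_isEvaluation hΩ
  have := hΦ.completeSpace hΩ
  refine Classical.epsilon_spec (p := IsBergmanKernel Ω)
    ⟨fun z w => Φ z (rieszRepr (Φ w)), fun w hw => ⟨⟨hΦ.differentiableOn_apply _, ?_⟩, ?_⟩⟩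
  · exact (memLp_congr_ae (hΦ.ae_eq hΩ (rieszRepr (Φ w)))).1 (Lp.memLp _)
  · intro f hf
    obtain ⟨F, hF⟩ := exists_bergmanIncl_eq hf
    rw [← inner_bergmanHilbert hF (hΦ.ae_eq hΩ (rieszRepr (Φ w))), inner_rieszRepr,
      hΦ w hw F f hf.1 hF]

theorem IsBergmanKernel.eq_apply_rieszRepr {K : (Fin d → ℂ) → (Fin d → ℂ) → ℂ}
    {Φ : (Fin d → ℂ) → StrongDual ℂ (BergmanHilbert Ω)} [CompleteSpace (BergmanHilbert Ω)]
    (hK : IsBergmanKernel Ω K) (hΦ : IsEvaluation Ω Φ) {z w : Fin d → ℂ} (hz : z ∈ Ω)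
    (hw : w ∈ Ω) : K z w = Φ z (rieszRepr (Φ w)) := by
  obtain ⟨hKw, hrep⟩ := hK w hw
  obtain ⟨G, hG⟩ := exists_bergmanIncl_eq hKw
  have h : rieszRepr (Φ w) = G := by
    refine ext_inner_right ℂ fun F => ?_
    obtain ⟨f, hf, hF⟩ := exists_rep F
    have hmem : f ∈ bergmanSpace Ω := ⟨hf, (memLp_congr_ae hF).1 (Lp.memLp _)⟩
    rw [inner_rieszRepr, inner_bergmanHilbert hF hG, hΦ w hw F f hf hF, hrep f hmem]
  rw [h, hΦ z hz G _ hKw.1 hG]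

/-- On the diagonal the Bergman kernel is the squared norm of the point evaluation. -/
theorem IsEvaluation.bergmanKernel_self {Φ : (Fin d → ℂ) → StrongDual ℂ (BergmanHilbert Ω)}
    (hΩ : IsOpen Ω) (hΦ : IsEvaluation Ω Φ) {z : Fin d → ℂ} (hz : z ∈ Ω) :
    bergmanKernel Ω z z = ((‖Φ z‖ ^ 2 : ℝ) : ℂ) := by
  have := hΦ.completeSpace hΩ
  rw [(isBergmanKernel_bergmanKernel hΩ).eq_apply_rieszRepr hΦ hz hz, apply_rieszRepr_self]

theorem mem_bergmanSpace_of_differentiable (hΩ : IsOpen Ω) (hb : Bornology.IsBounded Ω)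
    {f : (Fin d → ℂ) → ℂ} (hf : Differentiable ℂ f) : f ∈ bergmanSpace Ω := by
  refine ⟨hf.differentiableOn, ?_⟩
  have hfin : IsFiniteMeasure (volume.restrict Ω) := ⟨by simpa using hb.measure_lt_top⟩
  obtain ⟨C, hC⟩ := hb.isCompact_closure.exists_bound_of_continuousOn hf.continuous.continuousOn
  refine MemLp.of_bound hf.continuous.aestronglyMeasurable C ?_
  filter_upwards [ae_restrict_mem hΩ.measurableSet] with z hz
  exact hC z (subset_closure hz)

theorem IsEvaluation.ne_zero {Φ : (Fin d → ℂ) → StrongDual ℂ (BergmanHilbert Ω)}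
    (hΩ : IsOpen Ω) (hb : Bornology.IsBounded Ω) (hΦ : IsEvaluation Ω Φ) {z : Fin d → ℂ}
    (hz : z ∈ Ω) : Φ z ≠ 0 := by
  intro h
  have hmem := mem_bergmanSpace_of_differentiable hΩ hb (differentiable_const (1 : ℂ))
  obtain ⟨F, hF⟩ := exists_bergmanIncl_eq hmem
  have h1 := hΦ z hz F _ hmem.1 hF
  rw [h] at h1
  exact one_ne_zero h1.symm

/-- Constants and coordinate functions show that the Bergman metric is nondegenerate. -/
theorem IsEvaluation.eq_zero_of_fderiv_eq_smul
    {Φ : (Fin d → ℂ) → StrongDual ℂ (BergmanHilbert Ω)} (hΩ : IsOpen Ω)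
    (hb : Bornology.IsBounded Ω) (hΦ : IsEvaluation Ω Φ) {z : Fin d → ℂ} (hz : z ∈ Ω)
    {v : Fin d → ℂ} {c : ℂ} (h : fderiv ℂ Φ z v = c • Φ z) : v = 0 := by
  have key : ∀ f : (Fin d → ℂ) → ℂ, Differentiable ℂ f → fderiv ℂ f z v = c * f z := by
    intro f hf
    have hmem := mem_bergmanSpace_of_differentiable hΩ hb hf
    obtain ⟨F, hF⟩ := exists_bergmanIncl_eq hmem
    rw [← hΦ.fderiv_apply hΩ hz v hmem.1 hF, h, ← hΦ z hz F f hmem.1 hF]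
    rfl
  have hc : c = 0 := by simpa using (key _ (differentiable_const (1 : ℂ))).symm
  funext i
  have h1 := key (fun y => y i) (by fun_prop)
  rw [hc, zero_mul, show (fun y : Fin d → ℂ => y i) =
    ContinuousLinearMap.proj (R := ℂ) (φ := fun _ : Fin d => ℂ) i from rfl,
    ContinuousLinearMap.fderiv] at h1
  exact h1

/-- The restriction of the Bergman kernel to the diagonal, a real-valued function. -/
noncomputable def bergmanDiag (Ω : Set (Fin d → ℂ)) (z : Fin d → ℂ) : ℝ := (bergmanKernel Ω z z).re

theorem bergmanKernel_self_eq (hΩ : IsOpen Ω) {z : Fin d → ℂ} (hz : z ∈ Ω) :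
    bergmanKernel Ω z z = bergmanDiag Ω z := by
  obtain ⟨Φ, hΦ⟩ := exists_isEvaluation hΩ
  rw [bergmanDiag, hΦ.bergmanKernel_self hΩ hz, Complex.ofReal_re]

theorem bergmanDiag_pos (hΩ : IsOpen Ω) (hb : Bornology.IsBounded Ω) {z : Fin d → ℂ}
    (hz : z ∈ Ω) : 0 < bergmanDiag Ω z := by
  obtain ⟨Φ, hΦ⟩ := exists_isEvaluation hΩ
  rw [bergmanDiag, hΦ.bergmanKernel_self hΩ hz, Complex.ofReal_re]
  have := norm_pos_iff.2 (hΦ.ne_zero hΩ hb hz)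
  positivity

theorem contDiffOn_bergmanDiag (hΩ : IsOpen Ω) : ContDiffOn ℝ ∞ (bergmanDiag Ω) Ω := by
  obtain ⟨Φ, hΦ⟩ := exists_isEvaluation hΩ
  have := hΦ.completeSpace hΩ
  refine contDiffOn_of_eq_norm_sq hΩ (hΦ.differentiableOn hΩ) fun z hz => ?_
  rw [bergmanDiag, hΦ.bergmanKernel_self hΩ hz, Complex.ofReal_re]

theorem contDiffOn_log_bergmanDiag (hΩ : IsOpen Ω) (hb : Bornology.IsBounded Ω) :
    ContDiffOn ℝ ∞ (fun z => Real.log (bergmanDiag Ω z)) Ω :=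
  (contDiffOn_bergmanDiag hΩ).log fun _ hz => (bergmanDiag_pos hΩ hb hz).ne'

/-- The Bergman metric of a bounded domain is positive definite. -/
theorem posDef_bergmanMetric (hΩ : IsOpen Ω) (hb : Bornology.IsBounded Ω) {z : Fin d → ℂ}
    (hz : z ∈ Ω) : (bergmanMetric Ω z).PosDef := by
  obtain ⟨Φ, hΦ⟩ := exists_isEvaluation hΩ
  have := hΦ.completeSpace hΩ
  exact posDef_metricOfPotential_log_norm_sq (κ := bergmanDiag Ω) hΩ (hΦ.differentiableOn hΩ)
    (fun w hw => by rw [bergmanDiag, hΦ.bergmanKernel_self hΩ hw, Complex.ofReal_re])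
    (fun w hw => hΦ.ne_zero hΩ hb hw)
    (fun w hw v c h => hΦ.eq_zero_of_fderiv_eq_smul hΩ hb hw h) hz

end BergmanKernel

/-! ### Involutive automorphisms -/

section Automorphisms

open MeasureTheory Metric Set
open scoped Topology ComplexConjugate Real

variable {d : ℕ} {Ω : Set (Fin d → ℂ)} {s : (Fin d → ℂ) → (Fin d → ℂ)}

/-- The complex Jacobian matrix, with entries `∂s_l/∂z_j`. -/
noncomputable def jacobian (s : (Fin d → ℂ) → (Fin d → ℂ)) (z : Fin d → ℂ) :
    Matrix (Fin d) (Fin d) ℂ :=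
  LinearMap.toMatrix' (fderiv ℂ s z : (Fin d → ℂ) →ₗ[ℂ] (Fin d → ℂ))

theorem jacobian_apply (s : (Fin d → ℂ) → (Fin d → ℂ)) (z : Fin d → ℂ) (l j : Fin d) :
    jacobian s z l j = fderiv ℂ s z (Pi.single j 1) l := by
  simp [jacobian, LinearMap.toMatrix'_apply, Pi.single]

theorem differentiableOn_jacobian_apply (hΩ : IsOpen Ω) (hs : DifferentiableOn ℂ s Ω)
    (l j : Fin d) : DifferentiableOn ℂ (fun z => jacobian s z l j) Ω := by
  simp only [jacobian_apply]
  exact differentiableOn_pi.1 (differentiableOn_fderiv_apply hΩ hs _) l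

theorem differentiableOn_det_jacobian (hΩ : IsOpen Ω) (hs : DifferentiableOn ℂ s Ω) :
    DifferentiableOn ℂ (fun z => (jacobian s z).det) Ω := by
  simp only [Matrix.det_apply']
  refine DifferentiableOn.fun_sum fun σ _ => DifferentiableOn.const_mul (fun z hz => ?_) _
  exact (HasFDerivWithinAt.finsetProd (g := fun i z => jacobian s z (σ i) i) fun i _ =>
    (differentiableOn_jacobian_apply hΩ hs (σ i) i z hz).hasFDerivWithinAt).differentiableWithinAt

theorem det_restrictScalars_fderiv (s : (Fin d → ℂ) → (Fin d → ℂ)) (z : Fin d → ℂ) :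
    ((fderiv ℂ s z).restrictScalars ℝ).det = ‖(jacobian s z).det‖ ^ 2 := by
  have h := LinearMap.det_restrictScalars (R := ℝ) (S := ℂ)
    (f := (fderiv ℂ s z : (Fin d → ℂ) →ₗ[ℂ] (Fin d → ℂ)))
  rw [Algebra.norm_complex_apply, Complex.normSq_eq_norm_sq, ← LinearMap.det_toMatrix'] at h
  exact h

theorem det_jacobian_mul (hΩ : IsOpen Ω) (hs : DifferentiableOn ℂ s Ω) (hmaps : MapsTo s Ω Ω)
    (hinv : ∀ z ∈ Ω, s (s z) = z) {z : Fin d → ℂ} (hz : z ∈ Ω) :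
    (jacobian s (s z)).det * (jacobian s z).det = 1 := by
  have h1 := (hs.differentiableAt (hΩ.mem_nhds (hmaps hz))).hasFDerivAt
  have h2 := (hs.differentiableAt (hΩ.mem_nhds hz)).hasFDerivAt
  have h3 : (fun z => s (s z)) =ᶠ[𝓝 z] id := Filter.eventually_of_mem (hΩ.mem_nhds hz) hinv
  have h4 : (fderiv ℂ s (s z)).comp (fderiv ℂ s z) = ContinuousLinearMap.id ℂ _ :=
    (h1.comp z h2).unique ((hasFDerivAt_id z).congr_of_eventuallyEq h3)
  rw [← Matrix.det_mul, jacobian, jacobian, ← LinearMap.toMatrix'_comp,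
    ← ContinuousLinearMap.toLinearMap_comp, h4]
  simp

theorem image_eq_self (hmaps : MapsTo s Ω Ω) (hinv : ∀ z ∈ Ω, s (s z) = z) : s '' Ω = Ω :=
  subset_antisymm hmaps.image_subset fun z hz => ⟨s z, hmaps hz, hinv z hz⟩

theorem hasFDerivWithinAt_restrictScalars (hΩ : IsOpen Ω) (hs : DifferentiableOn ℂ s Ω)
    {z : Fin d → ℂ} (hz : z ∈ Ω) :
    HasFDerivWithinAt s ((fderiv ℂ s z).restrictScalars ℝ) Ω z :=
  ((hs.differentiableAt (hΩ.mem_nhds hz)).hasFDerivAt.restrictScalars ℝ).hasFDerivWithinAt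

/-- The change of variables formula for an involutive automorphism. -/
theorem setIntegral_eq_setIntegral_comp (hΩ : IsOpen Ω) (hs : DifferentiableOn ℂ s Ω)
    (hmaps : MapsTo s Ω Ω) (hinv : ∀ z ∈ Ω, s (s z) = z) (g : (Fin d → ℂ) → ℂ) :
    ∫ z in Ω, g z = ∫ z in Ω, ((‖(jacobian s z).det‖ ^ 2 : ℝ) : ℂ) * g (s z) := by
  have h := integral_image_eq_integral_abs_det_fderiv_smul volume hΩ.measurableSet
    (fun z hz => hasFDerivWithinAt_restrictScalars hΩ hs hz)
    (fun x hx y hy hxy => by rw [← hinv x hx, ← hinv y hy, hxy]) g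
  rw [image_eq_self hmaps hinv] at h
  simpa only [det_restrictScalars_fderiv, abs_of_nonneg (sq_nonneg ‖_‖), Complex.real_smul] using h

theorem comp_mul_det_jacobian_mem_bergmanSpace (hΩ : IsOpen Ω) (hs : DifferentiableOn ℂ s Ω)
    (hmaps : MapsTo s Ω Ω) (hinv : ∀ z ∈ Ω, s (s z) = z) {f : (Fin d → ℂ) → ℂ}
    (hf : f ∈ bergmanSpace Ω) : (fun z => (jacobian s z).det * f (s z)) ∈ bergmanSpace Ω := by
  have hd : DifferentiableOn ℂ (fun z => (jacobian s z).det * f (s z)) Ω :=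
    (differentiableOn_det_jacobian hΩ hs).mul (hf.1.comp hs hmaps)
  refine ⟨hd, (memLp_two_iff_integrable_sq_norm
    (hd.continuousOn.aestronglyMeasurable hΩ.measurableSet)).2 ?_⟩
  have h := (integrableOn_image_iff_integrableOn_abs_det_fderiv_smul volume hΩ.measurableSet
    (fun z hz => hasFDerivWithinAt_restrictScalars hΩ hs hz)
    (fun x hx y hy hxy => by rw [← hinv x hx, ← hinv y hy, hxy]) fun z => ‖f z‖ ^ 2).1
  rw [image_eq_self hmaps hinv] at h
  have h' := h ((memLp_two_iff_integrable_sq_norm hf.2.1).1 hf.2)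
  simp only [det_restrictScalars_fderiv, abs_of_nonneg (sq_nonneg ‖_‖), smul_eq_mul] at h'
  simp only [norm_mul, mul_pow]
  exact h'

/-- The transformation rule of the Bergman kernel under an involutive automorphism, on the
diagonal. -/
theorem bergmanDiag_eq_mul_comp (hΩ : IsOpen Ω) (hs : DifferentiableOn ℂ s Ω)
    (hmaps : MapsTo s Ω Ω) (hinv : ∀ z ∈ Ω, s (s z) = z) {w : Fin d → ℂ} (hw : w ∈ Ω) :
    bergmanDiag Ω w = ‖(jacobian s w).det‖ ^ 2 * bergmanDiag Ω (s w) := by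
  have hK := isBergmanKernel_bergmanKernel hΩ
  set K := bergmanKernel Ω with hKdef
  set J : (Fin d → ℂ) → ℂ := fun z => (jacobian s z).det with hJ
  have hJJ : ∀ z ∈ Ω, J (s z) * J z = 1 := fun z hz => det_jacobian_mul hΩ hs hmaps hinv hz
  -- The transformed kernel, as a function of the first variable.
  set k : (Fin d → ℂ) → ℂ := fun z => conj (J w) * (J z * K (s z) (s w)) with hk
  have hkmem : k ∈ bergmanSpace Ω := by
    have h := comp_mul_det_jacobian_mem_bergmanSpace hΩ hs hmaps hinv (hK (s w) (hmaps hw)).1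
    exact ⟨h.1.const_mul _, h.2.const_mul _⟩
  have hrep : ∀ f ∈ bergmanSpace Ω, ∫ z in Ω, f z * conj (k z) = f w := by
    intro f hf
    rw [setIntegral_eq_setIntegral_comp hΩ hs hmaps hinv]
    have h1 : ∀ z ∈ Ω, ((‖(jacobian s z).det‖ ^ 2 : ℝ) : ℂ) * (f (s z) * conj (k (s z))) =
        J w * ((J z * f (s z)) * conj (K z (s w))) := by
      intro z hz
      have h2 : ((‖(jacobian s z).det‖ ^ 2 : ℝ) : ℂ) = J z * conj (J z) := by
        rw [Complex.mul_conj, Complex.normSq_eq_norm_sq]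
      have h3 : conj (J (s z)) * conj (J z) = 1 := by rw [← map_mul, hJJ z hz, map_one]
      rw [h2, hk]
      simp only [hinv z hz, map_mul, Complex.conj_conj]
      linear_combination (J z * J w * f (s z) * conj (K z (s w))) * h3
    rw [setIntegral_congr_fun hΩ.measurableSet h1, integral_const_mul,
      ← (hK (s w) (hmaps hw)).2 _ (comp_mul_det_jacobian_mem_bergmanSpace hΩ hs hmaps hinv hf),
      hinv w hw]
    linear_combination f w * hJJ w hw
  -- `k` and `K(·, w)` both reproduce the value at `w`, so pairing them in two ways compares them.
  have h1 : K w w = ∫ z in Ω, K z w * conj (k z) := (hrep _ (hK w hw).1).symm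
  have h2 : k w = ∫ z in Ω, k z * conj (K z w) := (hK w hw).2 k hkmem
  have h3 : conj (k w) = K w w := by
    rw [h1, h2, ← integral_conj]
    refine integral_congr_ae (Filter.Eventually.of_forall fun z => ?_)
    simp [mul_comm]
  have h4 : ((‖J w‖ ^ 2 : ℝ) : ℂ) = J w * conj (J w) := by
    rw [Complex.mul_conj, Complex.normSq_eq_norm_sq]
  rw [hk] at h3
  simp only [map_mul, Complex.conj_conj] at h3
  rw [hKdef, bergmanKernel_self_eq hΩ hw, bergmanKernel_self_eq hΩ (hmaps hw), Complex.conj_ofReal] at h3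
  have h5 : ((‖J w‖ ^ 2 * bergmanDiag Ω (s w) : ℝ) : ℂ) = bergmanDiag Ω w := by
    rw [← h3, Complex.ofReal_mul, h4]
    ring
  exact_mod_cast h5.symm

/-- Cartan's linearization: an involution is conjugate to its derivative at a fixed point, through
`u z = (z - p) + s'(p) (s z - p)`. If the fixed point is isolated the derivative is `-1`. -/
theorem fderiv_apply_eq_neg (hΩ : IsOpen Ω) (hs : DifferentiableOn ℂ s Ω)
    (hinv : ∀ z ∈ Ω, s (s z) = z) {p : Fin d → ℂ} (hp : p ∈ Ω) (hsp : s p = p)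
    (hiso : ∀ᶠ z in 𝓝[≠] p, s z ≠ z) (v : Fin d → ℂ) : fderiv ℂ s p v = -v := by
  set A := fderiv ℂ s p with hA
  have hsA : HasStrictFDerivAt s A p :=
    ((contDiffOn_of_differentiableOn hΩ hs).contDiffAt (hΩ.mem_nhds hp)).hasStrictFDerivAt (by simp)
  have hAA : ∀ v, A (A v) = v := by
    have h1 : HasFDerivAt s A (s p) := by rw [hsp]; exact hsA.hasFDerivAt
    have h2 := h1.comp p hsA.hasFDerivAt
    have h3 : (s ∘ s) =ᶠ[𝓝 p] id := Filter.eventually_of_mem (hΩ.mem_nhds hp) hinv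
    have h4 := h2.unique ((hasFDerivAt_id p).congr_of_eventuallyEq h3)
    exact fun v => DFunLike.congr_fun h4 v
  let u : (Fin d → ℂ) → (Fin d → ℂ) := fun z => (z - p) + A (s z - p)
  have hus : ∀ z ∈ Ω, u (s z) = A (u z) := fun z hz => by
    simp only [u, map_add, hAA, hinv z hz]
    rw [add_comm]
  let e : (Fin d → ℂ) ≃L[ℂ] (Fin d → ℂ) :=
    ContinuousLinearEquiv.smulLeft (Units.mk0 (2 : ℂ) two_ne_zero)
  have hu : HasStrictFDerivAt u (e : (Fin d → ℂ) →L[ℂ] (Fin d → ℂ)) p := by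
    have h := ((hasStrictFDerivAt_id p).sub_const p).add
      (A.hasStrictFDerivAt.comp p (hsA.sub_const p))
    have he : (e : (Fin d → ℂ) →L[ℂ] (Fin d → ℂ)) = ContinuousLinearMap.id ℂ _ + A ∘SL A := by
      refine ContinuousLinearMap.ext fun v => ?_
      change (2 : ℂ) • v = v + A (A v)
      rw [hAA, two_smul]
    rw [he]
    exact h
  have hup : u p = 0 := by simp [u, hsp]
  set g := hu.localInverse u e p with hg
  -- Otherwise `w = v + A v` is a nonzero vector fixed by `A = s'(p)`, and the points `u⁻¹ (t w)`,
  -- `t → 0`, are fixed points of `s` that accumulate at `p`.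
  by_contra hne
  set w := v + A v with hw
  have hw0 : w ≠ 0 := fun h => hne (eq_neg_of_add_eq_zero_right h)
  have hAw : A w = w := by rw [hw, map_add, hAA, add_comm]
  have hgt : Filter.Tendsto g (𝓝 0) (𝓝 p) := by simpa only [hup] using hu.localInverse_tendsto
  have htw : Filter.Tendsto (fun t : ℂ => t • w) (𝓝[≠] 0) (𝓝 0) := by
    have : Filter.Tendsto (fun t : ℂ => t • w) (𝓝 0) (𝓝 ((0 : ℂ) • w)) :=
      (continuous_id.smul continuous_const).tendsto 0
    rw [zero_smul] at this
    exact this.mono_left nhdsWithin_le_nhds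
  have hx : Filter.Tendsto (fun t : ℂ => g (t • w)) (𝓝[≠] 0) (𝓝 p) := hgt.comp htw
  have hright : ∀ᶠ t : ℂ in 𝓝[≠] 0, u (g (t • w)) = t • w := by
    have h := hu.eventually_right_inverse
    rw [hup] at h
    exact htw.eventually h
  have hsx : Filter.Tendsto (fun t : ℂ => s (g (t • w))) (𝓝[≠] 0) (𝓝 p) := by
    have h : Filter.Tendsto s (𝓝 p) (𝓝 (s p)) := hsA.hasFDerivAt.continuousAt
    rw [hsp] at h
    exact h.comp hx
  have hfix : ∀ᶠ t : ℂ in 𝓝[≠] 0, s (g (t • w)) = g (t • w) := by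
    filter_upwards [hright, hsx.eventually hu.eventually_left_inverse,
      hx.eventually (hΩ.mem_nhds hp)] with t h1 h2 h3
    rw [← h2, hus _ h3, h1, map_smul, hAw]
  have hxne : Filter.Tendsto (fun t : ℂ => g (t • w)) (𝓝[≠] 0) (𝓝[≠] p) := by
    refine tendsto_nhdsWithin_iff.2 ⟨hx, ?_⟩
    filter_upwards [hright, self_mem_nhdsWithin] with t h1 h2 h3
    rw [mem_singleton_iff.1 h3, hup] at h1
    exact (smul_ne_zero h2 hw0) h1.symm
  obtain ⟨t, h1, h2⟩ := (hfix.and (hxne.eventually hiso)).exists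
  exact h2 h1

end Automorphisms

/-! ### The volume density of the Bergman metric -/

section BergmanDeterminant

open MeasureTheory Metric Set
open scoped Topology ComplexConjugate Real

variable {d : ℕ} {Ω : Set (Fin d → ℂ)} {s : (Fin d → ℂ) → (Fin d → ℂ)}

theorem contDiffOn_det {ι : Type*} [Fintype ι] [DecidableEq ι] {U : Set (ι → ℂ)}
    {A : (ι → ℂ) → Matrix ι ι ℂ} (hA : ∀ i j, ContDiffOn ℝ ∞ (fun x => A x i j) U) :
    ContDiffOn ℝ ∞ (fun x => (A x).det) U := by
  simp only [Matrix.det_apply']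
  exact ContDiffOn.sum fun σ _ => contDiffOn_const.mul (contDiffOn_prod fun i _ => hA _ _)

/-- Involutive automorphisms are isometries of the Bergman metric: the Jacobian factor in the
transformation rule of the kernel has a pluriharmonic logarithm. -/
theorem bergmanMetric_eq_mul (hΩ : IsOpen Ω) (hb : Bornology.IsBounded Ω)
    (hs : DifferentiableOn ℂ s Ω) (hmaps : MapsTo s Ω Ω) (hinv : ∀ z ∈ Ω, s (s z) = z)
    {x : Fin d → ℂ} (hx : x ∈ Ω) :
    bergmanMetric Ω x =
      (jacobian s x).transpose * bergmanMetric Ω (s x) * (jacobian s x).map conj := by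
  set J : (Fin d → ℂ) → ℂ := fun z => (jacobian s z).det with hJ
  set φ : (Fin d → ℂ) → ℂ := fun z => ((Real.log (bergmanDiag Ω z) : ℝ) : ℂ) with hφ
  have hφs : ContDiffOn ℝ ∞ φ Ω := contDiffOn_ofReal_comp (contDiffOn_log_bergmanDiag hΩ hb)
  have hJd : ∀ y ∈ Ω, DifferentiableAt ℂ J y := fun y hy =>
    (differentiableOn_det_jacobian hΩ hs).differentiableAt (hΩ.mem_nhds hy)
  have hsd : ∀ y ∈ Ω, DifferentiableAt ℂ s y := fun y hy => hs.differentiableAt (hΩ.mem_nhds hy)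
  have hJ0 : ∀ y ∈ Ω, J y ≠ 0 := fun y hy =>
    right_ne_zero_of_mul_eq_one (det_jacobian_mul hΩ hs hmaps hinv hy)
  have hJJ : ∀ y, J y * conj (J y) = ((‖J y‖ ^ 2 : ℝ) : ℂ) := fun y => by
    rw [Complex.mul_conj, Complex.normSq_eq_norm_sq]
  have hJJpos : ∀ y ∈ Ω, 0 < ‖J y‖ ^ 2 := fun y hy => by
    have := norm_pos_iff.2 (hJ0 y hy)
    positivity
  have hJconj : ∀ y ∈ Ω, DifferentiableAt ℝ (fun y => conj (J y)) y := fun y hy =>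
    Complex.conjCLE.differentiableAt.comp y ((hJd y hy).restrictScalars ℝ)
  have hprod : ∀ y ∈ Ω, DifferentiableAt ℝ (fun y => J y * conj (J y)) y := fun y hy =>
    ((hJd y hy).restrictScalars ℝ).mul (hJconj y hy)
  have hlog : ∀ y ∈ Ω, HasDerivAt Complex.log (J y * conj (J y))⁻¹ (J y * conj (J y)) := by
    intro y hy
    refine Complex.hasDerivAt_log ?_
    rw [hJJ]
    exact Complex.ofReal_mem_slitPlane.2 (hJJpos y hy)
  have hlogd : ∀ y ∈ Ω, DifferentiableAt ℝ (fun y => Complex.log (J y * conj (J y))) y :=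
    fun y hy => DifferentiableAt.comp (g := Complex.log) y
      ((hlog y hy).differentiableAt.restrictScalars ℝ) (hprod y hy)
  have hφd : ∀ y ∈ Ω, DifferentiableAt ℝ φ y := fun y hy => differentiableAt_of_contDiffOn hΩ hφs hy
  have hsplit : ∀ y ∈ Ω, φ y = Complex.log (J y * conj (J y)) + φ (s y) := by
    intro y hy
    simp only [hφ]
    rw [bergmanDiag_eq_mul_comp hΩ hs hmaps hinv hy, Real.log_mul (hJJpos y hy).ne'
      (bergmanDiag_pos hΩ hb (hmaps hy)).ne', Complex.ofReal_add, Complex.ofReal_log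
      (hJJpos y hy).le, hJJ]
  have hcomp : ∀ y ∈ Ω, DifferentiableAt ℝ (fun y => φ (s y)) y := fun y hy =>
    (hφd _ (hmaps hy)).comp y ((hsd y hy).restrictScalars ℝ)
  ext j k
  have hbar : ∀ y ∈ Ω, dzbar k φ y = conj (fderiv ℂ J y (Pi.single k 1) * (J y)⁻¹) +
      ∑ m, dzbar m φ (s y) * conj (jacobian s y m k) := by
    intro y hy
    rw [dzbar_congr (Filter.eventually_of_mem (hΩ.mem_nhds hy) hsplit),
      dzbar_add (hlogd y hy) (hcomp y hy), dzbar_comp (hprod y hy) (hlog y hy),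
      dzbar_mul ((hJd y hy).restrictScalars ℝ) (hJconj y hy), dzbar_of_differentiableAt (hJd y hy),
      dzbar_conj ((hJd y hy).restrictScalars ℝ), dz_of_differentiableAt (hJd y hy),
      dzbar_comp_of_differentiableAt (hφd _ (hmaps hy)) (hsd y hy)]
    have h1 : conj (J y) ≠ 0 := (map_ne_zero _).2 (hJ0 y hy)
    have h2 := hJ0 y hy
    have h3 : (J y * conj (J y))⁻¹ * (0 * conj (J y) +
        J y * conj (fderiv ℂ J y (Pi.single k 1))) =
        conj (fderiv ℂ J y (Pi.single k 1) * (J y)⁻¹) := by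
      rw [map_mul, map_inv₀]
      field_simp
      ring
    rw [h3]
    simp only [jacobian_apply]
  have hd1 : DifferentiableAt ℂ (fun y => fderiv ℂ J y (Pi.single k 1) * (J y)⁻¹) x :=
    ((differentiableOn_fderiv_apply hΩ (differentiableOn_det_jacobian hΩ hs) _).differentiableAt
      (hΩ.mem_nhds hx)).mul ((hJd x hx).inv (hJ0 x hx))
  have hd2 : ∀ m, DifferentiableAt ℂ (fun y => jacobian s y m k) x := fun m =>
    (differentiableOn_jacobian_apply hΩ hs m k).differentiableAt (hΩ.mem_nhds hx)
  have hconj : ∀ {f : (Fin d → ℂ) → ℂ}, DifferentiableAt ℂ f x →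
      DifferentiableAt ℝ (fun y => conj (f y)) x := fun hf =>
    Complex.conjCLE.differentiableAt.comp x (hf.restrictScalars ℝ)
  have hd3 : ∀ m, DifferentiableAt ℝ (dzbar m φ) (s x) := fun m =>
    differentiableAt_of_contDiffOn hΩ (contDiffOn_dzbar hΩ hφs m) (hmaps hx)
  have hd4 : ∀ m, DifferentiableAt ℝ (fun y => dzbar m φ (s y)) x := fun m =>
    (hd3 m).comp x ((hsd x hx).restrictScalars ℝ)
  have hd5 : ∀ m ∈ Finset.univ,
      DifferentiableAt ℝ (fun y => dzbar m φ (s y) * conj (jacobian s y m k)) x := fun m _ =>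
    (hd4 m).mul (hconj (hd2 m))
  change dz j (dzbar k φ) x = _
  rw [dz_congr (Filter.eventually_of_mem (hΩ.mem_nhds hx) hbar),
    dz_add (hconj hd1) (DifferentiableAt.fun_sum hd5),
    dz_conj_of_differentiableAt hd1, zero_add,
    dz_sum hd5, Matrix.mul_apply]
  refine Finset.sum_congr rfl fun m _ => ?_
  rw [dz_mul (hd4 m) (hconj (hd2 m)), dz_conj_of_differentiableAt (hd2 m), mul_zero, add_zero,
    dz_comp_of_differentiableAt (hd3 m) (hsd x hx), Matrix.mul_apply, Matrix.map_apply]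
  congr 1
  refine Finset.sum_congr rfl fun l _ => ?_
  rw [Matrix.transpose_apply, jacobian_apply, mul_comm]
  rfl

/-- On a bounded symmetric domain the volume density of the Bergman metric is a constant multiple
of the Bergman kernel. The quotient is invariant under the symmetry at each point `p`, whose
derivative at `p` is `-1`; so the derivative of the quotient vanishes at `p`. -/
theorem exists_log_det_bergmanMetric (hΩ : IsBoundedSymmetricDomain Ω) :
    ∃ c : ℝ, ∀ z ∈ Ω, Complex.log (bergmanMetric Ω z).det =
      ((c + Real.log (bergmanDiag Ω z) : ℝ) : ℂ) := by
  have ho := hΩ.isOpen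
  have hb := hΩ.isBounded
  have hdet : ∀ z ∈ Ω, 0 < (bergmanMetric Ω z).det := fun z hz =>
    (posDef_bergmanMetric ho hb hz).det_pos
  have hre : ∀ z ∈ Ω, (bergmanMetric Ω z).det = ((bergmanMetric Ω z).det.re : ℂ) := fun z hz =>
    (Complex.eq_re_of_ofReal_le (r := 0) (by simpa using (hdet z hz).le))
  have hrepos : ∀ z ∈ Ω, 0 < (bergmanMetric Ω z).det.re := fun z hz =>
    (Complex.pos_iff.1 (hdet z hz)).1
  let F : (Fin d → ℂ) → ℝ := fun z =>
    Real.log (bergmanMetric Ω z).det.re - Real.log (bergmanDiag Ω z)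
  have hlogK := contDiffOn_log_bergmanDiag ho hb
  have hF : ContDiffOn ℝ ∞ F Ω := by
    refine ContDiffOn.sub (ContDiffOn.log ?_ fun z hz => (hrepos z hz).ne') hlogK
    exact Complex.reCLM.contDiff.comp_contDiffOn
      (contDiffOn_det fun j k => contDiffOn_metricOfPotential ho hlogK j k)
  have hFd : DifferentiableOn ℝ F Ω := hF.differentiableOn (by simp)
  have hF0 : EqOn (fderiv ℝ F) 0 Ω := by
    intro p hp
    obtain ⟨s, hs, hmaps, hinv, hsp, hiso⟩ := hΩ.symmetry p hp
    have hFs : ∀ z ∈ Ω, F (s z) = F z := by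
      intro z hz
      have h1 : (bergmanMetric Ω z).det.re =
          ‖(jacobian s z).det‖ ^ 2 * (bergmanMetric Ω (s z)).det.re := by
        have h2 : (bergmanMetric Ω z).det =
            ((‖(jacobian s z).det‖ ^ 2 : ℝ) : ℂ) * (bergmanMetric Ω (s z)).det := by
          have h3 : ((jacobian s z).map conj).det = conj (jacobian s z).det :=
            (RingHom.map_det (starRingEnd ℂ) (jacobian s z)).symm
          rw [bergmanMetric_eq_mul ho hb hs hmaps hinv hz, Matrix.det_mul, Matrix.det_mul,
            Matrix.det_transpose, h3, ← Complex.normSq_eq_norm_sq, ← Complex.mul_conj]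
          ring
        rw [h2, Complex.re_ofReal_mul]
      have h0 : (‖(jacobian s z).det‖ ^ 2) ≠ 0 := by
        have := right_ne_zero_of_mul_eq_one (det_jacobian_mul ho hs hmaps hinv hz)
        positivity
      simp only [F]
      rw [h1, bergmanDiag_eq_mul_comp ho hs hmaps hinv hz,
        Real.log_mul h0 (hrepos _ (hmaps hz)).ne',
        Real.log_mul h0 (bergmanDiag_pos ho hb (hmaps hz)).ne']
      ring
    have hFp : HasFDerivAt F (fderiv ℝ F p) p := (hFd.differentiableAt (ho.mem_nhds hp)).hasFDerivAt
    have hFsp : HasFDerivAt F (fderiv ℝ F p) (s p) := by rwa [hsp]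
    have hsder := (hs.differentiableAt (ho.mem_nhds hp)).hasFDerivAt.restrictScalars ℝ
    have hcomp := (hFsp.comp p hsder).congr_of_eventuallyEq
      (Filter.eventually_of_mem (ho.mem_nhds hp) fun z hz => (hFs z hz).symm)
    have heq := hFp.unique hcomp
    ext v
    have hv := DFunLike.congr_fun heq v
    have hneg := fderiv_apply_eq_neg ho hs hinv hp hsp hiso v
    change fderiv ℝ F p v = fderiv ℝ F p (fderiv ℂ s p v) at hv
    rw [hneg, map_neg] at hv
    change fderiv ℝ F p v = 0
    linarith
  obtain ⟨c, hc⟩ := ho.exists_is_const_of_fderiv_eq_zero hΩ.isConnected.isPreconnected hFd hF0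
  refine ⟨c, fun z hz => ?_⟩
  have h1 : Real.log (bergmanMetric Ω z).det.re = c + Real.log (bergmanDiag Ω z) := by
    rw [← hc z hz]
    simp only [F]
    ring
  rw [hre z hz, ← Complex.ofReal_log (hrepos z hz).le, h1]

end BergmanDeterminant

/-! ### The metric of a Hartogs domain -/

section HartogsMetric

open Metric Set
open scoped Topology ComplexConjugate

variable {d : ℕ} {Ω : Set (Fin d → ℂ)} {E : (Fin d → ℂ) → ℝ}

/-- The Hartogs domain `{(z, w) ∈ Ω × ℂ : |w|² < E(z)}`. -/
def hartogsDomain (Ω : Set (Fin d → ℂ)) (E : (Fin d → ℂ) → ℝ) : Set (Fin (d + 1) → ℂ) :=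
  {x | zPart x ∈ Ω ∧ ‖wPart x‖ ^ 2 < E (zPart x)}

/-- The potential `-log(E(z) - |w|²)`. -/
noncomputable def hartogsPotential (E : (Fin d → ℂ) → ℝ) (x : Fin (d + 1) → ℂ) : ℝ :=
  -Real.log (E (zPart x) - ‖wPart x‖ ^ 2)

/-- The function `-log E`, pulled back to `Ω × ℂ`. -/
noncomputable def pullbackPotential (E : (Fin d → ℂ) → ℝ) (x : Fin (d + 1) → ℂ) : ℝ :=
  -Real.log (E (zPart x))

/-- The components of `∂w`. -/
noncomputable def dwVec (α : Fin (d + 1)) : ℂ := if α = Fin.last d then 1 else 0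

/-- The `(1, 0)`-form `w ∂(-log E) + dw`, whose square is the vertical part of the metric. -/
noncomputable def verticalForm (E : (Fin d → ℂ) → ℝ) (x : Fin (d + 1) → ℂ) (α : Fin (d + 1)) : ℂ :=
  wPart x * dz α (fun y => (pullbackPotential E y : ℂ)) x + dwVec α

/-- The projection `(z, w) ↦ z` as a continuous linear map. -/
noncomputable def zPartL (d : ℕ) : (Fin (d + 1) → ℂ) →L[ℂ] (Fin d → ℂ) :=
  ContinuousLinearMap.pi fun j => ContinuousLinearMap.proj j.castSucc

theorem hasFDerivAt_zPart (x : Fin (d + 1) → ℂ) : HasFDerivAt zPart (zPartL d) x :=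
  (zPartL d).hasFDerivAt

theorem hasFDerivAt_wPart (x : Fin (d + 1) → ℂ) :
    HasFDerivAt (wPart (d := d)) (ContinuousLinearMap.proj (R := ℂ)
      (φ := fun _ : Fin (d + 1) => ℂ) (Fin.last d)) x :=
  (ContinuousLinearMap.proj (R := ℂ) (φ := fun _ : Fin (d + 1) => ℂ) (Fin.last d)).hasFDerivAt

theorem continuous_zPart : Continuous (zPart (d := d)) := (zPartL d).continuous

theorem continuous_wPart : Continuous (wPart (d := d)) := continuous_apply (Fin.last d)

theorem dz_wPart (α : Fin (d + 1)) (x : Fin (d + 1) → ℂ) : dz α wPart x = dwVec α := by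
  rw [dz_of_differentiableAt (hasFDerivAt_wPart x).differentiableAt, (hasFDerivAt_wPart x).fderiv]
  simp [dwVec, Pi.single_apply, eq_comm]

theorem conj_dwVec (α : Fin (d + 1)) : conj (dwVec α) = dwVec α := by
  unfold dwVec
  split_ifs <;> simp

theorem isOpen_hartogsDomain (hΩ : IsOpen Ω) (hE : ContinuousOn E Ω) :
    IsOpen (hartogsDomain Ω E) := by
  have h1 : IsOpen (zPart ⁻¹' Ω : Set (Fin (d + 1) → ℂ)) := hΩ.preimage continuous_zPart
  have h2 : ContinuousOn (fun x : Fin (d + 1) → ℂ => E (zPart x) - ‖wPart x‖ ^ 2)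
      (zPart ⁻¹' Ω) :=
    (hE.comp continuous_zPart.continuousOn fun x hx => hx).sub
      (continuous_wPart.norm.pow 2).continuousOn
  have h3 := h2.isOpen_inter_preimage h1 (isOpen_Ioi (a := 0))
  convert h3 using 1
  ext x
  simp [hartogsDomain]

theorem contDiffOn_pullbackPotential (hE : ContDiffOn ℝ ∞ E Ω) (hpos : ∀ z ∈ Ω, 0 < E z) :
    ContDiffOn ℝ ∞ (pullbackPotential E) (zPart ⁻¹' Ω : Set (Fin (d + 1) → ℂ)) :=
  ((hE.log fun z hz => (hpos z hz).ne').comp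
    ((zPartL d).restrictScalars ℝ).contDiff.contDiffOn fun _ hx => hx).neg

theorem contDiffOn_hartogsPotential (hE : ContDiffOn ℝ ∞ E Ω) :
    ContDiffOn ℝ ∞ (hartogsPotential E) (hartogsDomain Ω E) := by
  have h1 : ContDiffOn ℝ ∞ (fun x : Fin (d + 1) → ℂ => E (zPart x)) (hartogsDomain Ω E) :=
    hE.comp ((zPartL d).restrictScalars ℝ).contDiff.contDiffOn fun _ hx => hx.1
  have h2 : ContDiff ℝ ∞ (fun x : Fin (d + 1) → ℂ => ‖wPart x‖ ^ 2) :=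
    ((ContinuousLinearMap.proj (R := ℝ) (φ := fun _ : Fin (d + 1) => ℂ)
      (Fin.last d)).contDiff).norm_sq ℝ
  exact ((h1.sub h2.contDiffOn).log fun x hx => (sub_pos.2 hx.2).ne').neg

/-- The metric with potential `-log(E - |w|²)` is the sum of a horizontal part, a multiple of the
metric with potential `-log E`, and a vertical part of rank one. -/
theorem metricOfPotential_hartogsPotential (hΩ : IsOpen Ω) (hE : ContDiffOn ℝ ∞ E Ω)
    (hpos : ∀ z ∈ Ω, 0 < E z) {x : Fin (d + 1) → ℂ} (hx : x ∈ hartogsDomain Ω E)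
    (α β : Fin (d + 1)) :
    metricOfPotential (hartogsPotential E) x α β =
      (E (zPart x) / (E (zPart x) - ‖wPart x‖ ^ 2) : ℝ) *
        metricOfPotential (pullbackPotential E) x α β +
      (E (zPart x) / (E (zPart x) - ‖wPart x‖ ^ 2) ^ 2 : ℝ) *
        (verticalForm E x α * conj (verticalForm E x β)) := by
  set Ψ : (Fin (d + 1) → ℂ) → ℂ := fun y => (pullbackPotential E y : ℂ) with hΨ
  set e : (Fin (d + 1) → ℂ) → ℂ := fun y => Complex.exp (-1 * Ψ y) with he
  set q : (Fin (d + 1) → ℂ) → ℂ := fun y => e y + -1 * (wPart y * conj (wPart y)) with hq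
  have hW : IsOpen (zPart ⁻¹' Ω : Set (Fin (d + 1) → ℂ)) := hΩ.preimage continuous_zPart
  have hM : IsOpen (hartogsDomain Ω E) := isOpen_hartogsDomain hΩ hE.continuousOn
  have hΨs : ContDiffOn ℝ ∞ Ψ (zPart ⁻¹' Ω) :=
    contDiffOn_ofReal_comp (contDiffOn_pullbackPotential hE hpos)
  have hΨd : ∀ y, zPart y ∈ Ω → DifferentiableAt ℝ Ψ y := fun y hy =>
    differentiableAt_of_contDiffOn hW hΨs hy
  have hEe : ∀ y, zPart y ∈ Ω → (E (zPart y) : ℂ) = e y := fun y hy => by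
    simp only [he, hΨ, pullbackPotential, Complex.ofReal_neg, neg_mul, one_mul, neg_neg]
    rw [← Complex.ofReal_exp, Real.exp_log (hpos _ hy)]
  have hEq : ∀ y, zPart y ∈ Ω → ((E (zPart y) - ‖wPart y‖ ^ 2 : ℝ) : ℂ) = q y := fun y hy => by
    simp only [hq]
    rw [← hEe y hy, Complex.mul_conj, Complex.normSq_eq_norm_sq]
    push_cast
    ring
  have hexp : ∀ y, HasDerivAt (fun t => Complex.exp (-1 * t)) (-1 * e y) (Ψ y) := fun y => by
    have := ((hasDerivAt_id (Ψ y)).const_mul (-1 : ℂ)).cexp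
    simpa [he, mul_comm] using this
  have hed : ∀ y, zPart y ∈ Ω → DifferentiableAt ℝ e y := fun y hy =>
    DifferentiableAt.comp (g := fun t => Complex.exp (-1 * t)) y
      ((hexp y).differentiableAt.restrictScalars ℝ) (hΨd y hy)
  have hwd : ∀ y : Fin (d + 1) → ℂ, DifferentiableAt ℂ wPart y := fun y =>
    (hasFDerivAt_wPart y).differentiableAt
  have hwr : ∀ y : Fin (d + 1) → ℂ, DifferentiableAt ℝ wPart y := fun y =>
    (hwd y).restrictScalars ℝ
  have hwc : ∀ y : Fin (d + 1) → ℂ, DifferentiableAt ℝ (fun y => conj (wPart y)) y := fun y =>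
    Complex.conjCLE.differentiableAt.comp y (hwr y)
  have hww : ∀ y : Fin (d + 1) → ℂ, DifferentiableAt ℝ (fun y => wPart y * conj (wPart y)) y :=
    fun y => (hwr y).mul (hwc y)
  have hww' : ∀ y : Fin (d + 1) → ℂ,
      DifferentiableAt ℝ (fun y => -1 * (wPart y * conj (wPart y))) y :=
    fun y => (hww y).const_mul (-1)
  have hqd : ∀ y, zPart y ∈ Ω → DifferentiableAt ℝ q y := fun y hy => (hed y hy).add (hww' y)
  have hqz : dz α q x = -(e x * dz α Ψ x) - conj (wPart x) * dwVec α := by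
    rw [hq, dz_add (hed x hx.1) (hww' x), dz_const_mul (hww x), dz_mul (hwr x) (hwc x),
      dz_conj_of_differentiableAt (hwd x), dz_comp (hΨd x hx.1) (hexp x)]
    rw [show dz α (fun y => wPart y) x = dwVec α from dz_wPart α x]
    ring
  have hqbar : ∀ y, zPart y ∈ Ω →
      dzbar β q y = -(e y * dzbar β Ψ y) - wPart y * dwVec β := by
    intro y hy
    rw [hq, dzbar_add (hed y hy) (hww' y), dzbar_const_mul (hww y), dzbar_mul (hwr y) (hwc y),
      dzbar_conj (hwr y), dzbar_comp (hΨd y hy) (hexp y)]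
    rw [show dzbar β (fun y => wPart y) y = 0 from dzbar_of_differentiableAt (hwd y) β, dz_wPart,
      conj_dwVec]
    ring
  have hqpos : ∀ y ∈ hartogsDomain Ω E, q y ∈ Complex.slitPlane := fun y hy => by
    rw [← hEq y hy.1]
    exact Complex.ofReal_mem_slitPlane.2 (sub_pos.2 hy.2)
  have hq0 : q x ≠ 0 := Complex.slitPlane_ne_zero (hqpos x hx)
  have hbar : ∀ y ∈ hartogsDomain Ω E,
      dzbar β (fun y => (hartogsPotential E y : ℂ)) y =
        (q y)⁻¹ * (e y * dzbar β Ψ y + dwVec β * wPart y) := by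
    intro y hy
    have hlog := (Complex.hasDerivAt_log (hqpos y hy))
    have heq : (fun y => (hartogsPotential E y : ℂ)) =ᶠ[𝓝 y] fun y => -1 * Complex.log (q y) := by
      refine Filter.eventually_of_mem (hM.mem_nhds hy) fun u hu => ?_
      change ((-Real.log (E (zPart u) - ‖wPart u‖ ^ 2) : ℝ) : ℂ) = -1 * Complex.log (q u)
      rw [← hEq u hu.1, ← Complex.ofReal_log (sub_pos.2 hu.2).le]
      push_cast
      ring
    have hlogd : DifferentiableAt ℝ (fun y => Complex.log (q y)) y :=
      DifferentiableAt.comp (g := Complex.log) y (hlog.differentiableAt.restrictScalars ℝ)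
        (hqd y hy.1)
    rw [dzbar_congr heq, dzbar_const_mul hlogd, dzbar_comp (hqd y hy.1) hlog, hqbar y hy.1]
    ring
  have hinv := hasDerivAt_inv hq0
  have hinvd : DifferentiableAt ℝ (fun y => (q y)⁻¹) x := (hqd x hx.1).inv hq0
  have hΨbar : DifferentiableAt ℝ (dzbar β Ψ) x :=
    differentiableAt_of_contDiffOn hW (contDiffOn_dzbar hW hΨs β) hx.1
  have hA : DifferentiableAt ℝ (fun y => e y * dzbar β Ψ y) x := (hed x hx.1).mul hΨbar
  have hB : DifferentiableAt ℝ (fun y => dwVec β * wPart y) x := (hwr x).const_mul _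
  have hAB : DifferentiableAt ℝ (fun y => e y * dzbar β Ψ y + dwVec β * wPart y) x := hA.add hB
  have hvert : conj (verticalForm E x β) = conj (wPart x) * dzbar β Ψ x + dwVec β := by
    rw [verticalForm, map_add, map_mul, conj_dwVec, ← dzbar_conj (hΨd x hx.1)]
    simp only [hΨ, Complex.conj_ofReal]
  have hqe : q x = e x - wPart x * conj (wPart x) := by rw [hq]; ring
  rw [hvert, verticalForm]
  change dz α (dzbar β fun y => (hartogsPotential E y : ℂ)) x = _ * dz α (dzbar β Ψ) x + _
  rw [dz_congr (Filter.eventually_of_mem (hM.mem_nhds hx) hbar), dz_mul hinvd hAB,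
    dz_comp (hqd x hx.1) hinv, hqz, dz_add hA hB, dz_mul (hed x hx.1) hΨbar,
    dz_comp (hΨd x hx.1) (hexp x), dz_const_mul (hwr x)]
  rw [show dz α (fun y => wPart y) x = dwVec α from dz_wPart α x, Complex.ofReal_div,
    Complex.ofReal_div, Complex.ofReal_pow, hEq x hx.1, hEe x hx.1]
  field_simp
  rw [hqe]
  ring

/-- The pulled back metric vanishes in the `w`-direction. -/
theorem metricOfPotential_pullbackPotential (hΩ : IsOpen Ω) (hE : ContDiffOn ℝ ∞ E Ω)
    (hpos : ∀ z ∈ Ω, 0 < E z) {x : Fin (d + 1) → ℂ} (hx : zPart x ∈ Ω) (α β : Fin (d + 1)) :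
    metricOfPotential (pullbackPotential E) x α β =
      ∑ j, ∑ k, metricOfPotential (fun z => -Real.log (E z)) (zPart x) j k *
        (if α = j.castSucc then 1 else 0) * (if β = k.castSucc then 1 else 0) := by
  have hW : IsOpen (zPart ⁻¹' Ω : Set (Fin (d + 1) → ℂ)) := hΩ.preimage continuous_zPart
  set ψ : (Fin d → ℂ) → ℂ := fun z => ((-Real.log (E z) : ℝ) : ℂ) with hψ
  have hψs : ContDiffOn ℝ ∞ ψ Ω :=
    contDiffOn_ofReal_comp ((hE.log fun z hz => (hpos z hz).ne').neg)
  have hψd : ∀ z ∈ Ω, DifferentiableAt ℝ ψ z := fun z hz => differentiableAt_of_contDiffOn hΩ hψs hz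
  have hzd : ∀ y : Fin (d + 1) → ℂ, DifferentiableAt ℂ (zPart (d := d)) y := fun y =>
    (hasFDerivAt_zPart y).differentiableAt
  have hcoord : ∀ (y : Fin (d + 1) → ℂ) (α : Fin (d + 1)) (k : Fin d),
      fderiv ℂ zPart y (Pi.single α 1) k = if α = k.castSucc then 1 else 0 := by
    intro y α k
    rw [(hasFDerivAt_zPart y).fderiv]
    simp [zPartL, Pi.single_apply, eq_comm]
  have hbar : ∀ y ∈ (zPart ⁻¹' Ω : Set (Fin (d + 1) → ℂ)),
      dzbar β (fun y => (pullbackPotential E y : ℂ)) y =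
        ∑ k : Fin d, (if β = k.castSucc then (1 : ℂ) else 0) * dzbar k ψ (zPart y) := by
    intro y hy
    rw [show (fun y => (pullbackPotential E y : ℂ)) = fun y => ψ (zPart y) from rfl,
      dzbar_comp_of_differentiableAt (hψd _ hy) (hzd y)]
    refine Finset.sum_congr rfl fun k _ => ?_
    rw [hcoord, mul_comm]
    split_ifs <;> simp
  have hd1 : ∀ k, DifferentiableAt ℝ (dzbar k ψ) (zPart x) := fun k =>
    differentiableAt_of_contDiffOn hΩ (contDiffOn_dzbar hΩ hψs k) hx
  have hd2 : ∀ k, DifferentiableAt ℝ (fun y => dzbar k ψ (zPart y)) x := fun k =>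
    (hd1 k).comp x ((hzd x).restrictScalars ℝ)
  change dz α (dzbar β fun y => (pullbackPotential E y : ℂ)) x = _
  rw [dz_congr (Filter.eventually_of_mem (hW.mem_nhds hx) hbar),
    dz_sum (fun k _ => (hd2 k).const_mul _), Finset.sum_comm]
  refine Finset.sum_congr rfl fun k _ => ?_
  rw [dz_const_mul (hd2 k), dz_comp_of_differentiableAt (hd1 k) (hzd x), Finset.mul_sum]
  refine Finset.sum_congr rfl fun j _ => ?_
  rw [hcoord, mul_comm]
  rfl

theorem metricOfPotential_pullbackPotential_castSucc (hΩ : IsOpen Ω) (hE : ContDiffOn ℝ ∞ E Ω)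
    (hpos : ∀ z ∈ Ω, 0 < E z) {x : Fin (d + 1) → ℂ} (hx : zPart x ∈ Ω) (j k : Fin d) :
    metricOfPotential (pullbackPotential E) x j.castSucc k.castSucc =
      metricOfPotential (fun z => -Real.log (E z)) (zPart x) j k := by
  rw [metricOfPotential_pullbackPotential hΩ hE hpos hx]
  simp [Finset.sum_ite_eq]

theorem metricOfPotential_pullbackPotential_last_left (hΩ : IsOpen Ω) (hE : ContDiffOn ℝ ∞ E Ω)
    (hpos : ∀ z ∈ Ω, 0 < E z) {x : Fin (d + 1) → ℂ} (hx : zPart x ∈ Ω) (β : Fin (d + 1)) :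
    metricOfPotential (pullbackPotential E) x (Fin.last d) β = 0 := by
  rw [metricOfPotential_pullbackPotential hΩ hE hpos hx]
  simp [(Fin.castSucc_lt_last _).ne']

theorem metricOfPotential_pullbackPotential_last_right (hΩ : IsOpen Ω) (hE : ContDiffOn ℝ ∞ E Ω)
    (hpos : ∀ z ∈ Ω, 0 < E z) {x : Fin (d + 1) → ℂ} (hx : zPart x ∈ Ω) (α : Fin (d + 1)) :
    metricOfPotential (pullbackPotential E) x α (Fin.last d) = 0 := by
  rw [metricOfPotential_pullbackPotential hΩ hE hpos hx]
  simp [(Fin.castSucc_lt_last _).ne']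

theorem verticalForm_last (hΩ : IsOpen Ω) (hE : ContDiffOn ℝ ∞ E Ω)
    (hpos : ∀ z ∈ Ω, 0 < E z) {x : Fin (d + 1) → ℂ} (hx : zPart x ∈ Ω) :
    verticalForm E x (Fin.last d) = 1 := by
  have hψs : ContDiffOn ℝ ∞ (fun z => ((-Real.log (E z) : ℝ) : ℂ)) Ω :=
    contDiffOn_ofReal_comp ((hE.log fun z hz => (hpos z hz).ne').neg)
  rw [verticalForm, show (fun y => (pullbackPotential E y : ℂ)) =
    fun y => (fun z => ((-Real.log (E z) : ℝ) : ℂ)) (zPart y) from rfl,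
    dz_comp_of_differentiableAt (s := zPart) (differentiableAt_of_contDiffOn hΩ hψs hx)
    (hasFDerivAt_zPart x).differentiableAt, (hasFDerivAt_zPart x).fderiv]
  simp [zPartL, dwVec]

end HartogsMetric

/-! ### Determinant and trace of rank-one updates -/

section RankOneUpdate

open Matrix
open scoped ComplexConjugate

variable {d : ℕ} {A : Matrix (Fin (d + 1)) (Fin (d + 1)) ℂ} {a : Fin (d + 1) → ℂ} {b c : ℝ}

/-- Conjugating by the unipotent matrix that maps the last basis vector to `a` reduces the
determinant to that of a block diagonal matrix. -/
theorem det_smul_add_vecMulVec (hrow : ∀ β, A (Fin.last d) β = 0)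
    (hcol : ∀ α, A α (Fin.last d) = 0) (ha : a (Fin.last d) = 1) :
    ((b : ℂ) • A + (c : ℂ) • vecMulVec a (star a)).det =
      (b : ℂ) ^ d * c * (A.submatrix Fin.castSucc Fin.castSucc).det := by
  set e : Fin (d + 1) → ℂ := Pi.single (Fin.last d) 1 with he
  have hse : star e = e := by
    rw [he, ← Pi.single_star]
    simp
  set L : Matrix (Fin (d + 1)) (Fin (d + 1)) ℂ := 1 + vecMulVec (a - e) e with hL
  have hLe : L *ᵥ e = a := by
    rw [hL, add_mulVec, one_mulVec, vecMulVec_mulVec]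
    simp [he]
  have hLA : L * A = A := by
    rw [hL, add_mul, one_mul, vecMulVec_mul, he, single_one_vecMul]
    have : A.row (Fin.last d) = 0 := funext hrow
    simp [this]
  have hAL : A * Lᴴ = A := by
    rw [hL, conjTranspose_add, conjTranspose_one, conjTranspose_vecMulVec, mul_add, mul_one,
      mul_vecMulVec, hse, he, mulVec_single_one]
    have : A.col (Fin.last d) = 0 := funext hcol
    simp [this]
  have heL : e ᵥ* Lᴴ = star a := by
    rw [← hLe, star_mulVec, hse]
  have hfact : (b : ℂ) • A + (c : ℂ) • vecMulVec a (star a) =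
      L * ((b : ℂ) • A + (c : ℂ) • vecMulVec e e) * Lᴴ := by
    rw [mul_add, mul_smul_comm, mul_smul_comm, hLA, mul_vecMulVec, hLe, add_mul, smul_mul_assoc,
      smul_mul_assoc, hAL, vecMulVec_mul, heL]
  have hdetL : L.det = 1 := by
    rw [hL, vecMulVec_eq Unit, det_one_add_replicateCol_mul_replicateRow]
    simp [he, ha]
  rw [hfact, det_mul, det_mul, det_conjTranspose, hdetL, star_one, one_mul, mul_one,
    det_succ_row _ (Fin.last d), Finset.sum_eq_single (Fin.last d)]
  · have hsub : ((b : ℂ) • A + (c : ℂ) • vecMulVec e e).submatrix (Fin.last d).succAbove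
        (Fin.last d).succAbove = (b : ℂ) • A.submatrix Fin.castSucc Fin.castSucc := by
      ext i j
      simp [he, vecMulVec_apply, Fin.succAbove_last, (Fin.castSucc_lt_last _).ne]
    rw [hsub, det_smul, Fintype.card_fin]
    simp only [Matrix.add_apply, Matrix.smul_apply, hrow, vecMulVec_apply, he, Pi.single_eq_same,
      smul_eq_mul, ← two_mul, pow_mul]
    simp
    ring
  · intro j _ hj
    simp [hrow, vecMulVec_apply, he, hj]
  · simp

theorem posDef_smul_add_vecMulVec (hrow : ∀ β, A (Fin.last d) β = 0)
    (hcol : ∀ α, A α (Fin.last d) = 0) (ha : a (Fin.last d) = 1)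
    (hA : (A.submatrix Fin.castSucc Fin.castSucc).PosDef) (hb : 0 < b) (hc : 0 < c) :
    ((b : ℂ) • A + (c : ℂ) • vecMulVec a (star a)).PosDef := by
  have hherm : A.IsHermitian := by
    refine IsHermitian.ext fun i j => ?_
    induction i using Fin.lastCases with
    | last => rw [hcol, hrow, star_zero]
    | cast i =>
      induction j using Fin.lastCases with
      | last => rw [hcol, hrow, star_zero]
      | cast j => exact hA.isHermitian.apply i j
  have hquad : ∀ v : Fin (d + 1) → ℂ, star v ⬝ᵥ A *ᵥ v =
      star (fun j => v (Fin.castSucc j)) ⬝ᵥ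
        (A.submatrix Fin.castSucc Fin.castSucc) *ᵥ fun j => v (Fin.castSucc j) := by
    intro v
    simp only [dotProduct, mulVec, Fin.sum_univ_castSucc, hrow, hcol, zero_mul, add_zero,
      Finset.sum_const_zero, mul_zero, submatrix_apply, Pi.star_apply]
  have hsemi : A.PosSemidef := by
    refine PosSemidef.of_dotProduct_mulVec_nonneg hherm fun v => ?_
    rw [hquad]
    exact hA.posSemidef.dotProduct_mulVec_nonneg _
  have hbC : (0 : ℂ) < b := Complex.zero_lt_real.2 hb
  have hcC : (0 : ℂ) < c := Complex.zero_lt_real.2 hc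
  have hvert := posSemidef_vecMulVec_self_star a
  refine PosDef.of_dotProduct_mulVec_pos ((hsemi.smul hbC.le).add (hvert.smul hcC.le)).isHermitian
    fun v hv => ?_
  rw [add_mulVec, dotProduct_add, smul_mulVec, smul_mulVec, dotProduct_smul, dotProduct_smul,
    smul_eq_mul, smul_eq_mul]
  by_cases hv' : (fun j => v (Fin.castSucc j)) = 0
  · have hvw : v (Fin.last d) ≠ 0 := by
      intro h
      refine hv (funext fun i => ?_)
      induction i using Fin.lastCases with
      | last => exact h
      | cast i => exact congrFun hv' i
    have h1 : star a ⬝ᵥ v = v (Fin.last d) := by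
      rw [dotProduct, Fin.sum_univ_castSucc]
      have : ∀ i : Fin d, v i.castSucc = 0 := fun i => congrFun hv' i
      simp [this, ha]
    have h2 : star v ⬝ᵥ vecMulVec a (star a) *ᵥ v = (‖v (Fin.last d)‖ ^ 2 : ℝ) := by
      rw [vecMulVec_mulVec, h1, dotProduct_smul, star_dotProduct, h1,
        ← Complex.normSq_eq_norm_sq, ← Complex.mul_conj]
      simp [mul_comm]
    rw [h2]
    refine add_pos_of_nonneg_of_pos (mul_nonneg hbC.le (hsemi.dotProduct_mulVec_nonneg v))
      (mul_pos hcC (Complex.zero_lt_real.2 ?_))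
    have := norm_pos_iff.2 hvw
    positivity
  · refine add_pos_of_pos_of_nonneg (mul_pos hbC ?_)
      (mul_nonneg hcC.le (hvert.dotProduct_mulVec_nonneg v))
    rw [hquad]
    exact hA.dotProduct_mulVec_pos hv'

/-- The last basis vector `e` satisfies `G e = c a`, so that `G⁻¹ a a^*` has trace `1 / c`. -/
theorem trace_inv_mul (hrow : ∀ β, A (Fin.last d) β = 0)
    (hcol : ∀ α, A α (Fin.last d) = 0) (ha : a (Fin.last d) = 1)
    (hA : (A.submatrix Fin.castSucc Fin.castSucc).PosDef) (hb : 0 < b) (hc : 0 < c) :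
    (((b : ℂ) • A + (c : ℂ) • vecMulVec a (star a))⁻¹ * A).trace = d / b := by
  set G := (b : ℂ) • A + (c : ℂ) • vecMulVec a (star a) with hG
  have hunit : IsUnit G.det := (isUnit_iff_isUnit_det _).1
    (posDef_smul_add_vecMulVec hrow hcol ha hA hb hc).isUnit
  have hb0 : (b : ℂ) ≠ 0 := by exact_mod_cast hb.ne'
  set e : Fin (d + 1) → ℂ := Pi.single (Fin.last d) 1 with he
  have hGe : G *ᵥ e = (c : ℂ) • a := by
    have h1 : A *ᵥ e = 0 := by
      rw [he, mulVec_single_one]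
      exact funext hcol
    rw [hG, add_mulVec, smul_mulVec, smul_mulVec, h1, vecMulVec_mulVec]
    simp [he, ha]
  have hinv : (c : ℂ) • (G⁻¹ *ᵥ a) = e := by
    rw [← mulVec_smul, ← hGe, mulVec_mulVec, nonsing_inv_mul _ hunit, one_mulVec]
  have h1 : (1 : Matrix (Fin (d + 1)) (Fin (d + 1)) ℂ) =
      (b : ℂ) • (G⁻¹ * A) + vecMulVec e (star a) := by
    rw [← nonsing_inv_mul _ hunit]
    conv_lhs => rw [hG]
    rw [← hG, mul_add, mul_smul_comm, mul_smul_comm, mul_vecMulVec, ← hinv, smul_vecMulVec]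
  have h2 := congrArg trace h1
  rw [trace_one, trace_add, trace_smul, trace_vecMulVec, Fintype.card_fin] at h2
  have h3 : e ⬝ᵥ star a = 1 := by simp [he, ha]
  rw [h3, smul_eq_mul] at h2
  rw [eq_div_iff hb0]
  push_cast at h2
  linear_combination -h2

end RankOneUpdate

/-! ### Curvature of the Hartogs metric -/

section HartogsCurvature

open Metric Set
open scoped Topology ComplexConjugate

variable {d : ℕ} {Ω : Set (Fin d → ℂ)} {E : (Fin d → ℂ) → ℝ}

theorem metricOfPotential_hartogsPotential_eq (hΩ : IsOpen Ω) (hE : ContDiffOn ℝ ∞ E Ω)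
    (hpos : ∀ z ∈ Ω, 0 < E z) {x : Fin (d + 1) → ℂ} (hx : x ∈ hartogsDomain Ω E) :
    metricOfPotential (hartogsPotential E) x =
      ((E (zPart x) / (E (zPart x) - ‖wPart x‖ ^ 2) : ℝ) : ℂ) •
        metricOfPotential (pullbackPotential E) x +
      ((E (zPart x) / (E (zPart x) - ‖wPart x‖ ^ 2) ^ 2 : ℝ) : ℂ) •
        Matrix.vecMulVec (verticalForm E x) (star (verticalForm E x)) := by
  ext α β
  rw [metricOfPotential_hartogsPotential hΩ hE hpos hx]
  rfl

theorem submatrix_metricOfPotential_pullbackPotential (hΩ : IsOpen Ω) (hE : ContDiffOn ℝ ∞ E Ω)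
    (hpos : ∀ z ∈ Ω, 0 < E z) {x : Fin (d + 1) → ℂ} (hx : zPart x ∈ Ω) :
    (metricOfPotential (pullbackPotential E) x).submatrix Fin.castSucc Fin.castSucc =
      metricOfPotential (fun z => -Real.log (E z)) (zPart x) := by
  ext j k
  exact metricOfPotential_pullbackPotential_castSucc hΩ hE hpos hx j k

theorem posDef_hartogsMetric (hΩ : IsOpen Ω) (hE : ContDiffOn ℝ ∞ E Ω)
    (hpos : ∀ z ∈ Ω, 0 < E z)
    (hH : ∀ z ∈ Ω, (metricOfPotential (fun z => -Real.log (E z)) z).PosDef)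
    {x : Fin (d + 1) → ℂ} (hx : x ∈ hartogsDomain Ω E) :
    (metricOfPotential (hartogsPotential E) x).PosDef := by
  rw [metricOfPotential_hartogsPotential_eq hΩ hE hpos hx]
  have hq : 0 < E (zPart x) - ‖wPart x‖ ^ 2 := sub_pos.2 hx.2
  refine posDef_smul_add_vecMulVec
    (metricOfPotential_pullbackPotential_last_left hΩ hE hpos hx.1)
    (metricOfPotential_pullbackPotential_last_right hΩ hE hpos hx.1)
    (verticalForm_last hΩ hE hpos hx.1) ?_ (div_pos (hpos _ hx.1) hq)
    (div_pos (hpos _ hx.1) (pow_pos hq 2))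
  rw [submatrix_metricOfPotential_pullbackPotential hΩ hE hpos hx.1]
  exact hH _ hx.1

/-- If `det ∂∂̄(-log E)` is a constant multiple of `E ^ (-t)`, the Ricci form of the Hartogs metric
is a combination of the metric and of the horizontal form. -/
theorem ricci_hartogsMetric (hΩ : IsOpen Ω) (hE : ContDiffOn ℝ ∞ E Ω)
    (hpos : ∀ z ∈ Ω, 0 < E z) {c t : ℝ}
    (hH : ∀ z ∈ Ω, (metricOfPotential (fun z => -Real.log (E z)) z).PosDef)
    (hdet : ∀ z ∈ Ω, Complex.log (metricOfPotential (fun z => -Real.log (E z)) z).det =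
      ((c - t * Real.log (E z) : ℝ) : ℂ))
    {x : Fin (d + 1) → ℂ} (hx : x ∈ hartogsDomain Ω E) :
    ricci (metricOfPotential (hartogsPotential E)) x =
      (-(d + 2) : ℂ) • metricOfPotential (hartogsPotential E) x +
        (d + 1 - t : ℂ) • metricOfPotential (pullbackPotential E) x := by
  have hW : IsOpen (zPart ⁻¹' Ω : Set (Fin (d + 1) → ℂ)) := hΩ.preimage continuous_zPart
  have hM : IsOpen (hartogsDomain Ω E) := isOpen_hartogsDomain hΩ hE.continuousOn
  set P : (Fin (d + 1) → ℂ) → ℂ := fun y => (hartogsPotential E y : ℂ) with hP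
  set Ψ : (Fin (d + 1) → ℂ) → ℂ := fun y => (pullbackPotential E y : ℂ) with hΨ
  have hPs : ContDiffOn ℝ ∞ P (hartogsDomain Ω E) :=
    contDiffOn_ofReal_comp (contDiffOn_hartogsPotential hE)
  have hΨs : ContDiffOn ℝ ∞ Ψ (zPart ⁻¹' Ω) :=
    contDiffOn_ofReal_comp (contDiffOn_pullbackPotential hE hpos)
  have hPd : ∀ y ∈ hartogsDomain Ω E, DifferentiableAt ℝ P y := fun y hy =>
    differentiableAt_of_contDiffOn hM hPs hy
  have hΨd : ∀ y ∈ hartogsDomain Ω E, DifferentiableAt ℝ Ψ y := fun y hy =>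
    differentiableAt_of_contDiffOn hW hΨs hy.1
  have hlog : ∀ y ∈ hartogsDomain Ω E,
      Complex.log (metricOfPotential (hartogsPotential E) y).det =
        (d + 2 : ℂ) * P y + (t - (d + 1) : ℂ) * Ψ y + c := by
    intro y hy
    have hE0 := hpos _ hy.1
    have hq : 0 < E (zPart y) - ‖wPart y‖ ^ 2 := sub_pos.2 hy.2
    have hdet0 := (hH _ hy.1).det_pos
    have h1 : (metricOfPotential (fun z => -Real.log (E z)) (zPart y)).det =
        ((Real.exp (c - t * Real.log (E (zPart y))) : ℝ) : ℂ) := by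
      rw [Complex.ofReal_exp, ← hdet _ hy.1, Complex.exp_log hdet0.ne']
    rw [metricOfPotential_hartogsPotential_eq hΩ hE hpos hy, det_smul_add_vecMulVec
      (metricOfPotential_pullbackPotential_last_left hΩ hE hpos hy.1)
      (metricOfPotential_pullbackPotential_last_right hΩ hE hpos hy.1)
      (verticalForm_last hΩ hE hpos hy.1),
      submatrix_metricOfPotential_pullbackPotential hΩ hE hpos hy.1, h1]
    rw [← Complex.ofReal_pow, ← Complex.ofReal_mul, ← Complex.ofReal_mul,
      ← Complex.ofReal_log (by positivity), Real.log_mul (by positivity) (by positivity),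
      Real.log_mul (by positivity) (by positivity), Real.log_pow, Real.log_exp,
      Real.log_div hE0.ne' hq.ne', Real.log_div hE0.ne' (by positivity), Real.log_pow]
    simp only [hP, hΨ, hartogsPotential, pullbackPotential]
    push_cast
    ring
  have hbar : ∀ k, ∀ y ∈ hartogsDomain Ω E,
      dzbar k (fun y => Complex.log (metricOfPotential (hartogsPotential E) y).det) y =
        (d + 2 : ℂ) * dzbar k P y + (t - (d + 1) : ℂ) * dzbar k Ψ y := by
    intro k y hy
    have e1 := (hPd y hy).const_mul (d + 2 : ℂ)
    have e2 := (hΨd y hy).const_mul (t - (d + 1) : ℂ)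
    have e3 : DifferentiableAt ℝ (fun y => (d + 2 : ℂ) * P y + (t - (d + 1) : ℂ) * Ψ y) y :=
      e1.add e2
    rw [dzbar_congr (Filter.eventually_of_mem (hM.mem_nhds hy) hlog),
      dzbar_add e3 (differentiableAt_const _), dzbar_add e1 e2, dzbar_const_mul (hPd y hy),
      dzbar_const_mul (hΨd y hy), dzbar_const, add_zero]
  ext j k
  have hPk : DifferentiableAt ℝ (dzbar k P) x :=
    differentiableAt_of_contDiffOn hM (contDiffOn_dzbar hM hPs k) hx
  have hΨk : DifferentiableAt ℝ (dzbar k Ψ) x :=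
    differentiableAt_of_contDiffOn hW (contDiffOn_dzbar hW hΨs k) hx.1
  rw [ricci, Matrix.of_apply, dz_congr (Filter.eventually_of_mem (hM.mem_nhds hx) (hbar k)),
    dz_add (hPk.const_mul _) (hΨk.const_mul _), dz_const_mul hPk, dz_const_mul hΨk]
  change _ = (-(d + 2) : ℂ) * dz j (dzbar k P) x + (d + 1 - t : ℂ) * dz j (dzbar k Ψ) x
  ring

theorem scalarCurvature_eq_trace {ι : Type*} [Fintype ι] [DecidableEq ι]
    (g : (ι → ℂ) → Matrix ι ι ℂ) (x : ι → ℂ) :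
    scalarCurvature g x = ((g x)⁻¹ * ricci g x).trace := by
  rw [scalarCurvature, Finset.sum_comm]
  rfl

theorem scalarCurvature_hartogsMetric (hΩ : IsOpen Ω) (hE : ContDiffOn ℝ ∞ E Ω)
    (hpos : ∀ z ∈ Ω, 0 < E z) {c t : ℝ}
    (hH : ∀ z ∈ Ω, (metricOfPotential (fun z => -Real.log (E z)) z).PosDef)
    (hdet : ∀ z ∈ Ω, Complex.log (metricOfPotential (fun z => -Real.log (E z)) z).det =
      ((c - t * Real.log (E z) : ℝ) : ℂ))
    {x : Fin (d + 1) → ℂ} (hx : x ∈ hartogsDomain Ω E) :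
    scalarCurvature (metricOfPotential (hartogsPotential E)) x =
      ((d * (d + 1 - t) * ((E (zPart x) - ‖wPart x‖ ^ 2) / E (zPart x)) -
        (d + 2) * (d + 1) : ℝ) : ℂ) := by
  have hE0 := hpos _ hx.1
  have hq : 0 < E (zPart x) - ‖wPart x‖ ^ 2 := sub_pos.2 hx.2
  have hG := posDef_hartogsMetric hΩ hE hpos hH hx
  have hunit := (Matrix.isUnit_iff_isUnit_det _).1 hG.isUnit
  have hsub : ((metricOfPotential (pullbackPotential E) x).submatrix Fin.castSucc
      Fin.castSucc).PosDef := by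
    rw [submatrix_metricOfPotential_pullbackPotential hΩ hE hpos hx.1]
    exact hH _ hx.1
  have htr := trace_inv_mul
    (metricOfPotential_pullbackPotential_last_left hΩ hE hpos hx.1)
    (metricOfPotential_pullbackPotential_last_right hΩ hE hpos hx.1)
    (verticalForm_last hΩ hE hpos hx.1) hsub (div_pos hE0 hq) (div_pos hE0 (pow_pos hq 2))
  rw [← metricOfPotential_hartogsPotential_eq hΩ hE hpos hx] at htr
  rw [scalarCurvature_eq_trace, ricci_hartogsMetric hΩ hE hpos hH hdet hx, mul_add, mul_smul_comm,
    mul_smul_comm, Matrix.nonsing_inv_mul _ hunit, Matrix.trace_add, Matrix.trace_smul,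
    Matrix.trace_smul, Matrix.trace_one, htr, Fintype.card_fin, smul_eq_mul, smul_eq_mul]
  push_cast
  field_simp
  ring

end HartogsCurvature

/-! ### Powers of the generic norm -/

section GenericNorm

open MeasureTheory Set
open scoped Topology

variable {d : ℕ} {Ω : Set (Fin d → ℂ)}

theorem genus_pos (Ω : Set (Fin d → ℂ)) : (0 : ℝ) < genus Ω := by
  have : 0 < genus Ω := by
    unfold genus
    omega
  exact_mod_cast this

theorem volume_real_pos (hΩ : IsBoundedSymmetricDomain Ω) : 0 < volume.real Ω :=
  ENNReal.toReal_pos (hΩ.isOpen.measure_pos volume hΩ.isConnected.nonempty).ne'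
    hΩ.isBounded.measure_lt_top.ne

theorem genericNorm_rpow_pos (hΩ : IsBoundedSymmetricDomain Ω) (μ : ℝ) {z : Fin d → ℂ}
    (hz : z ∈ Ω) : 0 < genericNorm Ω z ^ μ :=
  Real.rpow_pos_of_pos (Real.rpow_pos_of_pos
    (mul_pos (volume_real_pos hΩ) (bergmanDiag_pos hΩ.isOpen hΩ.isBounded hz)) _) _

theorem log_genericNorm_rpow (hΩ : IsBoundedSymmetricDomain Ω) (μ : ℝ) {z : Fin d → ℂ}
    (hz : z ∈ Ω) : Real.log (genericNorm Ω z ^ μ) =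
      -(μ / genus Ω) * (Real.log (volume.real Ω) + Real.log (bergmanDiag Ω z)) := by
  have hK := bergmanDiag_pos hΩ.isOpen hΩ.isBounded hz
  have hVK := mul_pos (volume_real_pos hΩ) hK
  rw [← Real.log_mul (volume_real_pos hΩ).ne' hK.ne']
  change Real.log (((volume.real Ω * bergmanDiag Ω z) ^ (-1 / (genus Ω : ℝ))) ^ μ) = _
  rw [Real.log_rpow (Real.rpow_pos_of_pos hVK _), Real.log_rpow hVK]
  ring

theorem contDiffOn_genericNorm_rpow (hΩ : IsBoundedSymmetricDomain Ω) (μ : ℝ) :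
    ContDiffOn ℝ ∞ (fun z => genericNorm Ω z ^ μ) Ω := by
  have h : ContDiffOn ℝ ∞ (fun z => Real.exp
      (-(μ / genus Ω) * (Real.log (volume.real Ω) + Real.log (bergmanDiag Ω z)))) Ω :=
    (contDiffOn_const.mul (contDiffOn_const.add
      (contDiffOn_log_bergmanDiag hΩ.isOpen hΩ.isBounded))).exp
  refine h.congr fun z hz => ?_
  rw [← log_genericNorm_rpow hΩ μ hz, Real.exp_log (genericNorm_rpow_pos hΩ μ hz)]

/-- The metric with potential `-log N^μ` is a multiple of the Bergman metric. -/
theorem metricOfPotential_log_genericNorm (hΩ : IsBoundedSymmetricDomain Ω) (μ : ℝ)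
    {z : Fin d → ℂ} (hz : z ∈ Ω) :
    metricOfPotential (fun z => -Real.log (genericNorm Ω z ^ μ)) z =
      ((μ / genus Ω : ℝ) : ℂ) • bergmanMetric Ω z := by
  have ho := hΩ.isOpen
  have hs := contDiffOn_ofReal_comp (contDiffOn_log_bergmanDiag ho hΩ.isBounded)
  have hd : ∀ y ∈ Ω, DifferentiableAt ℝ (fun z => ((Real.log (bergmanDiag Ω z) : ℝ) : ℂ)) y :=
    fun y hy => differentiableAt_of_contDiffOn ho hs hy
  have heq : ∀ y ∈ Ω, ((-Real.log (genericNorm Ω y ^ μ) : ℝ) : ℂ) =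
      ((μ / genus Ω * Real.log (volume.real Ω) : ℝ) : ℂ) +
        ((μ / genus Ω : ℝ) : ℂ) * ((Real.log (bergmanDiag Ω y) : ℝ) : ℂ) := by
    intro y hy
    rw [log_genericNorm_rpow hΩ μ hy]
    push_cast
    ring
  ext j k
  have hbar : ∀ y ∈ Ω, dzbar k (fun z => ((-Real.log (genericNorm Ω z ^ μ) : ℝ) : ℂ)) y =
      ((μ / genus Ω : ℝ) : ℂ) * dzbar k (fun z => ((Real.log (bergmanDiag Ω z) : ℝ) : ℂ)) y := by
    intro y hy
    rw [dzbar_congr (Filter.eventually_of_mem (ho.mem_nhds hy) heq),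
      dzbar_add (differentiableAt_const _) ((hd y hy).const_mul _), dzbar_const, zero_add,
      dzbar_const_mul (hd y hy)]
  rw [metricOfPotential, Matrix.of_apply,
    dz_congr (Filter.eventually_of_mem (ho.mem_nhds hz) hbar),
    dz_const_mul (differentiableAt_of_contDiffOn ho (contDiffOn_dzbar ho hs k) hz)]
  rfl

theorem posDef_metricOfPotential_log_genericNorm (hΩ : IsBoundedSymmetricDomain Ω) {μ : ℝ}
    (hμ : 0 < μ) {z : Fin d → ℂ} (hz : z ∈ Ω) :
    (metricOfPotential (fun z => -Real.log (genericNorm Ω z ^ μ)) z).PosDef := by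
  rw [metricOfPotential_log_genericNorm hΩ μ hz]
  exact (posDef_bergmanMetric hΩ.isOpen hΩ.isBounded hz).smul
    (Complex.zero_lt_real.2 (div_pos hμ (genus_pos Ω)))

theorem exists_log_det_metricOfPotential_log_genericNorm (hΩ : IsBoundedSymmetricDomain Ω) {μ : ℝ}
    (hμ : 0 < μ) : ∃ c : ℝ, ∀ z ∈ Ω,
      Complex.log (metricOfPotential (fun z => -Real.log (genericNorm Ω z ^ μ)) z).det =
        ((c - genus Ω / μ * Real.log (genericNorm Ω z ^ μ) : ℝ) : ℂ) := by
  obtain ⟨c, hc⟩ := exists_log_det_bergmanMetric hΩ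
  have hγ := genus_pos Ω
  have hν : 0 < μ / genus Ω := div_pos hμ hγ
  refine ⟨d * Real.log (μ / genus Ω) + c - Real.log (volume.real Ω), fun z hz => ?_⟩
  have hdet : (bergmanMetric Ω z).det =
      ((Real.exp (c + Real.log (bergmanDiag Ω z)) : ℝ) : ℂ) := by
    rw [Complex.ofReal_exp, ← hc z hz,
      Complex.exp_log (posDef_bergmanMetric hΩ.isOpen hΩ.isBounded hz).det_pos.ne']
  rw [metricOfPotential_log_genericNorm hΩ μ hz, Matrix.det_smul, Fintype.card_fin, hdet,
    ← Complex.ofReal_pow, ← Complex.ofReal_mul, ← Complex.ofReal_log (by positivity),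
    Real.log_mul (by positivity) (by positivity), Real.log_pow, Real.log_exp,
    log_genericNorm_rpow hΩ μ hz]
  congr 1
  field_simp
  ring

end GenericNorm

end CartanHartogs

/-! ### Scalar curvature and the Einstein condition -/

theorem corollary2p3 (d : ℕ) (Ω : Set (Fin d → ℂ))
    (hΩ : CartanHartogs.IsBoundedSymmetricDomain Ω)
    (hirr : CartanHartogs.IsIrreducibleDomain Ω) (μ : ℝ) (hμ : 0 < μ) :
    CartanHartogs.IsKahlerMetricOn (CartanHartogs.cartanHartogsDomain Ω μ)
      (CartanHartogs.cartanHartogsMetric Ω μ) ∧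
    (∀ x ∈ CartanHartogs.cartanHartogsDomain Ω μ,
      CartanHartogs.scalarCurvature (CartanHartogs.cartanHartogsMetric Ω μ) x =
        (((d : ℝ) * (μ * ((d : ℝ) + 1) - (CartanHartogs.genus Ω : ℝ)) / μ *
          ((CartanHartogs.genericNorm Ω (CartanHartogs.zPart x) ^ μ -
              ‖CartanHartogs.wPart x‖ ^ 2) /
            CartanHartogs.genericNorm Ω (CartanHartogs.zPart x) ^ μ) -
          ((d : ℝ) + 2) * ((d : ℝ) + 1) : ℝ) : ℂ)) ∧
    ((∃ c : ℝ, ∀ x ∈ CartanHartogs.cartanHartogsDomain Ω μ,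
        CartanHartogs.scalarCurvature (CartanHartogs.cartanHartogsMetric Ω μ) x = (c : ℂ)) ↔
      μ * ((d : ℝ) + 1) = (CartanHartogs.genus Ω : ℝ)) ∧
    (CartanHartogs.IsKahlerEinsteinOn (CartanHartogs.cartanHartogsDomain Ω μ)
        (CartanHartogs.cartanHartogsMetric Ω μ) ↔
      μ * ((d : ℝ) + 1) = (CartanHartogs.genus Ω : ℝ)) := by
  open CartanHartogs in
  set E : (Fin d → ℂ) → ℝ := fun z => genericNorm Ω z ^ μ with hEdef
  have hM : cartanHartogsDomain Ω μ = hartogsDomain Ω E := rfl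
  have hg : cartanHartogsMetric Ω μ = metricOfPotential (hartogsPotential E) := rfl
  have hE := contDiffOn_genericNorm_rpow hΩ μ
  have hpos : ∀ z ∈ Ω, 0 < E z := fun z hz => genericNorm_rpow_pos hΩ μ hz
  have hH : ∀ z ∈ Ω, (metricOfPotential (fun z => -Real.log (E z)) z).PosDef := fun z hz =>
    posDef_metricOfPotential_log_genericNorm hΩ hμ hz
  obtain ⟨c₀, hdet⟩ := exists_log_det_metricOfPotential_log_genericNorm hΩ hμ
  have hopen : IsOpen (hartogsDomain Ω E) := isOpen_hartogsDomain hΩ.isOpen hE.continuousOn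
  have hposG : ∀ x ∈ hartogsDomain Ω E, (metricOfPotential (hartogsPotential E) x).PosDef :=
    fun x hx => posDef_hartogsMetric hΩ.isOpen hE hpos hH hx
  have hK : IsKahlerMetricOn (cartanHartogsDomain Ω μ) (cartanHartogsMetric Ω μ) := by
    rw [hM, hg]
    exact isKahlerMetricOn_metricOfPotential hopen (contDiffOn_hartogsPotential hE) hposG
  have hcoef : (d : ℝ) * (μ * (d + 1) - genus Ω) / μ = d * (d + 1 - genus Ω / μ) := by
    field_simp
  have hS : ∀ x ∈ cartanHartogsDomain Ω μ, scalarCurvature (cartanHartogsMetric Ω μ) x =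
      (((d : ℝ) * (μ * ((d : ℝ) + 1) - (genus Ω : ℝ)) / μ *
        ((genericNorm Ω (zPart x) ^ μ - ‖wPart x‖ ^ 2) / genericNorm Ω (zPart x) ^ μ) -
          ((d : ℝ) + 2) * ((d : ℝ) + 1) : ℝ) : ℂ) := by
    intro x hx
    rw [hcoef]
    exact scalarCurvature_hartogsMetric hΩ.isOpen hE hpos hH hdet hx
  have hconst : (∃ c : ℝ, ∀ x ∈ cartanHartogsDomain Ω μ,
      scalarCurvature (cartanHartogsMetric Ω μ) x = (c : ℂ)) ↔
        μ * ((d : ℝ) + 1) = (genus Ω : ℝ) := by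
    constructor
    · rintro ⟨c, hc⟩
      obtain ⟨z, hz⟩ := hΩ.isConnected.nonempty
      have hEz := hpos z hz
      -- Compare the values at `w = 0` and at `|w|² = E(z) / 2`.
      have hval : ∀ w : ℝ, w ^ 2 < E z → (d : ℝ) * (μ * ((d : ℝ) + 1) - (genus Ω : ℝ)) / μ *
          ((E z - w ^ 2) / E z) - ((d : ℝ) + 2) * ((d : ℝ) + 1) = c := by
        intro w hw
        have hzx : zPart (Fin.snoc z (w : ℂ) : Fin (d + 1) → ℂ) = z := by
          funext j
          simp [zPart]
        have hwx : wPart (Fin.snoc z (w : ℂ) : Fin (d + 1) → ℂ) = w := by simp [wPart]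
        have hx : (Fin.snoc z (w : ℂ) : Fin (d + 1) → ℂ) ∈ cartanHartogsDomain Ω μ := by
          refine ⟨by rwa [hzx], ?_⟩
          rw [hzx, hwx, Complex.norm_real, Real.norm_eq_abs, sq_abs]
          exact hw
        have h := (hS _ hx).symm.trans (hc _ hx)
        rw [hzx, hwx, Complex.norm_real, Real.norm_eq_abs, sq_abs] at h
        exact_mod_cast h
      have h0 := hval 0 (by simpa using hEz)
      have h1 := hval (Real.sqrt (E z / 2)) (by rw [Real.sq_sqrt (by positivity)]; linarith)
      rw [Real.sq_sqrt (by positivity)] at h1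
      have hd : (0 : ℝ) < d := by exact_mod_cast hirr.1
      have e0 : (E z - 0 ^ 2) / E z = 1 := by field_simp; ring
      have e1 : (E z - E z / 2) / E z = 1 / 2 := by field_simp; ring
      rw [e0] at h0
      rw [e1] at h1
      have h2 : (d : ℝ) * (μ * ((d : ℝ) + 1) - (genus Ω : ℝ)) / μ = 0 := by linarith
      have h3 := (div_eq_zero_iff.1 h2).resolve_right hμ.ne'
      linarith [(mul_eq_zero.1 h3).resolve_left hd.ne']
    · intro h
      refine ⟨-(((d : ℝ) + 2) * ((d : ℝ) + 1)), fun x hx => ?_⟩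
      rw [hS x hx, h]
      simp
  refine ⟨hK, hS, hconst, ⟨?_, fun h => ⟨hK, -((d : ℝ) + 2), fun x hx => ?_⟩⟩⟩
  · rintro ⟨-, c, hc⟩
    -- The trace of the Einstein equation shows that the scalar curvature is constant.
    refine hconst.1 ⟨c * (d + 1), fun x hx => ?_⟩
    have hunit := (Matrix.isUnit_iff_isUnit_det _).1 (hposG x hx).isUnit
    rw [scalarCurvature_eq_trace, hc x hx, mul_smul_comm, hg, Matrix.nonsing_inv_mul _ hunit,
      Matrix.trace_smul, Matrix.trace_one, Fintype.card_fin, smul_eq_mul]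
    push_cast
    ring
  · have ht : (d + 1 - ((genus Ω / μ : ℝ) : ℂ) : ℂ) = 0 := by
      have : (genus Ω / μ : ℝ) = d + 1 := by rw [← h]; field_simp
      rw [this]
      push_cast
      ring
    have hR := ricci_hartogsMetric hΩ.isOpen hE hpos hH hdet hx
    rw [ht, zero_smul, add_zero] at hR
    rw [hg, hR]
    push_cast
    rfl
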